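/- Let $\ell>0$, let $q:\mathbb{R}\to\mathbb{R}$ be periodic with period $\ell$ and integrable over a period, and let $\alpha\in[0,\pi)$. Consider Hill's equation $$-y''+q(x)\,y=z\,y,\qquad 0\le x<\infty, \tag{1}$$ where a solution is a differentiable function $y$ whose derivative $y'$ is locally absolutely continuous and which satisfies the equation almost everywhere. For $z\in\mathbb{C}$ let $\theta(\cdot,z),\varphi(\cdot,z)$ be the solutions of (1) with $$\theta(0)=\cos\alpha,\quad \theta'(0)=\sin\alpha,\qquad \varphi(0)=-\sin\alpha,\quad \varphi'(0)=\cos\alpha .$$ Then for every $z$ with $\operatorname{Im}z\neq0$ there is a unique $m(z)\in\mathbb{C}$ with $\theta(\cdot,z)+m(z)\varphi(\cdot,z)\in L^2(0,\infty)$ (the Titchmarsh–Weyl $m$-function). Call $\lambda\in\mathbb{R}$ a periodic (semi-periodic) eigenvalue if (1) with $z=\lambda$ has a nontrivial solution with $y(\ell)=y(0)$, $y'(\ell)=y'(0)$ (respectively $y(\ell)=-y(0)$, $y'(\ell)=-y'(0)$). Counted with multiplicity, the periodic eigenvalues $\lambda_n$ and the semi-periodic eigenvalues $\mu_n$ occur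 in the order $\lambda_0<\mu_0\le\mu_1<\lambda_1\le\lambda_2<\mu_2\le\mu_3<\lambda_3\le\cdots$. The stability intervals are the open intervals $(\lambda_0,\mu_0),(\mu_1,\lambda_1),(\lambda_2,\mu_2),(\mu_3,\lambda_3),\dots$, that is, the open intervals bounded by a periodic and a semi-periodic eigenvalue that contain no periodic or semi-periodic eigenvalue. Let $\lambda$ be in a stability interval, and let $u,v$ be the real solutions of (1) for $z=\lambda$ with $u(0)=1$, $u'(0)=0$, $v(0)=0$, $v'(0)=1$. Then $4-[u(\ell)+v'(\ell)]^2>0$, the denominator below is nonzero, the limit $$f(\lambda)=\frac1\pi\lim_{\varepsilon\to0^+}\operatorname{Im}m(\lambda+i\varepsilon)$$ (the spectral density at $\lambda$) exists, and $$f(\lambda)=\left|\frac{\sqrt{4-[u(\ell)+v'(\ell)]^2}}{2\pi\left[u'(\ell)\sin^2\alpha+(u(\ell)-v'(\ell))\cos\alpha\sin\alpha-v(\ell)\cos^2\alpha\right]}\right| .$$ -/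

import Mathlib

open Set Filter Topology MeasureTheory

namespace Hill

/-- `y`, with derivative `dy`, solves `-y'' + q y = z y` on `[0, ∞)`: `y` is differentiable with
derivative `dy`, and `dy` is a primitive of `(q - z) y`, that is, `dy` is locally absolutely
continuous and the equation holds almost everywhere (everywhere if `q` is continuous). -/
structure IsSolution {𝕜 : Type*} [RCLike 𝕜] (q : ℝ → ℝ) (z : 𝕜) (y dy : ℝ → 𝕜) : Prop where
  hasDeriv : ∀ x : ℝ, 0 ≤ x → HasDerivWithinAt y (dy x) (Ici 0) x
  equation : ∀ x : ℝ, 0 ≤ x → dy x = dy 0 + ∫ t in (0 : ℝ)..x, (q t • y t - z * y t)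

/-- The solution of the initial value problem `y(0) = a`, `y'(0) = b`. -/
structure IsSolutionIVP {𝕜 : Type*} [RCLike 𝕜] (q : ℝ → ℝ) (z a b : 𝕜) (y dy : ℝ → 𝕜) : Prop
    extends IsSolution q z y dy where
  init : y 0 = a
  init_deriv : dy 0 = b

/-- `lam` is an eigenvalue of the regular problem `-y'' + q y = lam y` on `[0, ℓ]` with boundary
conditions `y(0) = s y(ℓ)`, `y'(0) = s y'(ℓ)`. -/
def IsEigenvalue (q : ℝ → ℝ) (ℓ s lam : ℝ) : Prop :=
  ∃ y dy : ℝ → ℝ, IsSolution q lam y dy ∧ (∃ x ∈ Icc 0 ℓ, y x ≠ 0) ∧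
    y 0 = s * y ℓ ∧ dy 0 = s * dy ℓ

/-- Eigenvalues of the periodic problem. -/
def IsPeriodicEigenvalue (q : ℝ → ℝ) (ℓ lam : ℝ) : Prop := IsEigenvalue q ℓ 1 lam

/-- Eigenvalues of the semi-periodic (antiperiodic) problem. -/
def IsSemiperiodicEigenvalue (q : ℝ → ℝ) (ℓ lam : ℝ) : Prop := IsEigenvalue q ℓ (-1) lam

/-- `(a, b)` is a stability interval. The periodic eigenvalues `λₙ` and the semi-periodic
eigenvalues `μₙ` occur in the order `λ₀ < μ₀ ≤ μ₁ < λ₁ ≤ λ₂ < μ₂ ≤ μ₃ < λ₃ ≤ λ₄ < ...`, and the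
stability intervals are `(λ₀, μ₀), (μ₁, λ₁), (λ₂, μ₂), (μ₃, λ₃), ...`: the open intervals between a
periodic and a semi-periodic eigenvalue that are adjacent in this order. -/
def IsStabilityInterval (q : ℝ → ℝ) (ℓ a b : ℝ) : Prop :=
  a < b ∧
  ((IsPeriodicEigenvalue q ℓ a ∧ IsSemiperiodicEigenvalue q ℓ b) ∨
    (IsSemiperiodicEigenvalue q ℓ a ∧ IsPeriodicEigenvalue q ℓ b)) ∧
  ∀ x ∈ Ioo a b, ¬ IsPeriodicEigenvalue q ℓ x ∧ ¬ IsSemiperiodicEigenvalue q ℓ x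

/-- `m` is a Titchmarsh-Weyl coefficient at `z`: `θ(·, z) + m φ(·, z)` lies in `L²(0, ∞)`, where
`θ(0) = cos α`, `θ'(0) = sin α`, `φ(0) = -sin α`, `φ'(0) = cos α`. -/
def IsTitchmarshWeyl (q : ℝ → ℝ) (α : ℝ) (z m : ℂ) : Prop :=
  ∃ θ dθ φ dφ : ℝ → ℂ,
    IsSolutionIVP q z (Real.cos α : ℂ) (Real.sin α : ℂ) θ dθ ∧
    IsSolutionIVP q z (-(Real.sin α : ℂ)) (Real.cos α : ℂ) φ dφ ∧
    MemLp (fun x => θ x + m * φ x) 2 (volume.restrict (Ioi 0))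

open Classical in
/-- The Titchmarsh-Weyl `m`-function (with value `0` at points where no coefficient exists). -/
noncomputable def titchmarshWeylM (q : ℝ → ℝ) (α : ℝ) (z : ℂ) : ℂ :=
  if h : ∃ m : ℂ, IsTitchmarshWeyl q α z m then h.choose else 0

/-- `f` is the value at `lam` of the spectral density function
`(1/π) lim_{ε → 0+} Im m(lam + iε)`; the existence of the limit is part of the claim. -/
def IsSpectralDensityAt (q : ℝ → ℝ) (α lam f : ℝ) : Prop :=
  Tendsto (fun ε : ℝ => 1 / Real.pi * (titchmarshWeylM q α (lam + ε * Complex.I)).im)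
    (𝓝[>] 0) (𝓝 f)

end Hill

/-! Let M(z) be the monodromy matrix over one period; it has determinant 1 (Wronskian) and trace
T(z). For real z, T(z) = ±2 exactly at periodic and semi-periodic eigenvalues (`isEigenvalue_iff`),
so continuity of T and the intermediate value theorem give |T| < 2 in a stability interval. There M
is elliptic, so its quadratic form is definite and the denominator does not vanish.

For Im z ≠ 0, Green's identity excludes eigenvalues of M of modulus 1, so there is one inside the
unit disc, ρ, and one outside. The Floquet solution of ρ is in L², that of the other is not; hence θ
+ mφ must be the former (`exists_weyl_floquet`). In the basis of the initial data of θ and φ, let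
(A, B) be the first row of M. Then A + Bm = ρ, and ρ² − Tρ + 1 = 0 gives (m + C)² = (T² − 4)/(2B)²
with C = (2A − T)/(2B). As z → λ the right side tends to −K² with K > 0, while C becomes real. No
branch of the root has to be followed: Green's identity also gives Im m > 0 in the upper half plane,
which forces Im m → K (`tendsto_im_of_tendsto_sq`), and K/π is the claimed density.

Since q is only locally integrable, the ODE theory is built from integral equations. -/

namespace Hill

/-! ### Absolute continuity of primitives -/

section Primitive

variable {E : Type*} [NormedAddCommGroup E] [NormedSpace ℝ E]

/-- The primitive of an integrable function is absolutely continuous. -/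
theorem absolutelyContinuousOnInterval_primitive {f : ℝ → E} {a b : ℝ}
    (hf : IntervalIntegrable f volume a b) :
    AbsolutelyContinuousOnInterval (fun x => ∫ t in a..x, f t) a b := by
  -- Increments of the primitive of `f` are dominated by those of the scalar primitive of `‖f‖`.
  have h := hf.norm.absolutelyContinuousOnInterval_intervalIntegral (c := a) (by simp)
  rw [absolutelyContinuousOnInterval_iff] at h ⊢
  intro ε hε
  obtain ⟨δ, hδ, H⟩ := h ε hε
  refine ⟨δ, hδ, fun I hI hlen => lt_of_le_of_lt (Finset.sum_le_sum fun i hi => ?_) (H I hI hlen)⟩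
  have hmem := hI.1 i hi
  have h1 : IntervalIntegrable f volume a (I.2 i).1 :=
    hf.mono_set (uIcc_subset_uIcc left_mem_uIcc hmem.1)
  have h2 : IntervalIntegrable f volume a (I.2 i).2 :=
    hf.mono_set (uIcc_subset_uIcc left_mem_uIcc hmem.2)
  rw [dist_eq_norm, dist_eq_norm, intervalIntegral.integral_interval_sub_left h1 h2,
    intervalIntegral.integral_interval_sub_left h1.norm h2.norm, Real.norm_eq_abs]
  exact intervalIntegral.norm_integral_le_abs_integral_norm

theorem continuousOn_primitive_Icc [CompleteSpace E] {f : ℝ → E} {b : ℝ} (hb : 0 ≤ b)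
    (hf : IntervalIntegrable f volume 0 b) :
    ContinuousOn (fun x => ∫ t in (0 : ℝ)..x, f t) (Icc 0 b) := by
  simpa [uIcc_of_le hb] using (absolutelyContinuousOnInterval_primitive hf).continuousOn

end Primitive

/-! ### Product rule for primitives -/

section Product

variable {𝕜 : Type*} [RCLike 𝕜]

/-- Product rule for primitives. -/
theorem primitive_mul_primitive {f g : ℝ → 𝕜} {b : ℝ} (c d : 𝕜)
    (hf : IntervalIntegrable f volume 0 b) (hg : IntervalIntegrable g volume 0 b) :
    (c + ∫ t in (0 : ℝ)..b, f t) * (d + ∫ t in (0 : ℝ)..b, g t) - c * d =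
      ∫ x in (0 : ℝ)..b, (f x * (d + ∫ t in (0 : ℝ)..x, g t) +
        (c + ∫ t in (0 : ℝ)..x, f t) * g x) := by
  have hconst : ∀ e : 𝕜, AbsolutelyContinuousOnInterval (fun _ : ℝ => e) 0 b := fun e =>
    (contDiff_const.contDiffOn).absolutelyContinuousOnInterval
  have hF := (hconst c).fun_add (absolutelyContinuousOnInterval_primitive hf)
  have hG := (hconst d).fun_add (absolutelyContinuousOnInterval_primitive hg)
  set F : ℝ → 𝕜 := fun x => c + ∫ t in (0 : ℝ)..x, f t with hFdef
  set G : ℝ → 𝕜 := fun x => d + ∫ t in (0 : ℝ)..x, g t with hGdef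
  have hint : IntervalIntegrable (fun x => f x * G x + F x * g x) volume 0 b :=
    (hf.mul_continuousOn hG.continuousOn).add (hg.continuousOn_mul hF.continuousOn)
  -- FG minus the candidate primitive is absolutely continuous with derivative zero almost
  -- everywhere, hence constant.
  have hac := (hF.fun_smul hG).fun_sub (absolutelyContinuousOnInterval_primitive hint)
  obtain ⟨C, hC⟩ := hac.const_of_ae_hasDerivAt_zero (by
    filter_upwards [hf.ae_hasDerivAt_integral, hg.ae_hasDerivAt_integral,
      hint.ae_hasDerivAt_integral] with x h1 h2 h3 hx
    have k1 : HasDerivAt F (f x) x := (h1 hx 0 left_mem_uIcc).const_add c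
    have k2 : HasDerivAt G (g x) x := (h2 hx 0 left_mem_uIcc).const_add d
    have := (k1.mul k2).sub (h3 hx 0 left_mem_uIcc)
    simpa [Pi.mul_def, Pi.sub_def] using this)
  have e1 := hC 0 left_mem_uIcc
  have e2 := hC b right_mem_uIcc
  simp only [smul_eq_mul, intervalIntegral.integral_same, hFdef, hGdef, add_zero, sub_zero]
    at e1 e2
  rw [e1, ← e2]
  ring

/-- Product rule for functions that are primitives on an interval. -/
theorem mul_sub_mul_eq_integral {f g F G : ℝ → 𝕜} {b : ℝ} (hb : 0 ≤ b)
    (hf : IntervalIntegrable f volume 0 b) (hg : IntervalIntegrable g volume 0 b)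
    (hF : ∀ x ∈ Icc 0 b, F x = F 0 + ∫ t in (0 : ℝ)..x, f t)
    (hG : ∀ x ∈ Icc 0 b, G x = G 0 + ∫ t in (0 : ℝ)..x, g t) :
    F b * G b - F 0 * G 0 = ∫ x in (0 : ℝ)..b, (f x * G x + F x * g x) := by
  have hbm : b ∈ Icc 0 b := right_mem_Icc.2 hb
  rw [hF b hbm, hG b hbm, primitive_mul_primitive _ _ hf hg]
  refine intervalIntegral.integral_congr fun x hx => ?_
  rw [uIcc_of_le hb] at hx
  simp only [hF x hx, hG x hx]

end Product

/-! ### Grönwall's inequality -/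

section Gronwall

open scoped Nat

variable {g : ℝ → ℝ}

/-- Induction by the product rule for G and Gⁿ⁺¹/(n+1)!. It produces the exponential series in both
the Grönwall and the Picard estimates. -/
theorem integral_mul_primitive_pow {b : ℝ} (hg : IntervalIntegrable g volume 0 b) (hb : 0 ≤ b)
    (n : ℕ) :
    ∫ x in (0 : ℝ)..b, g x * ((∫ t in (0 : ℝ)..x, g t) ^ n / n !) =
      (∫ t in (0 : ℝ)..b, g t) ^ (n + 1) / (n + 1)! := by
  induction n generalizing b with
  | zero => simp
  | succ n ih =>
    set G : ℝ → ℝ := fun x => ∫ t in (0 : ℝ)..x, g t with hG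
    have hsub : ∀ x ∈ Icc 0 b, IntervalIntegrable g volume 0 x := fun x hx =>
      hg.mono_set (by rw [uIcc_of_le hx.1, uIcc_of_le hb]; exact Icc_subset_Icc_right hx.2)
    have hGc : ContinuousOn G (uIcc 0 b) := by
      rw [uIcc_of_le hb]; exact continuousOn_primitive_Icc hb hg
    have key := mul_sub_mul_eq_integral (F := G) (G := fun x => G x ^ (n + 1) / (n + 1)!) hb hg
      (hg.mul_continuousOn ((hGc.pow n).div_const (n ! : ℝ))) (fun x _ => by simp [hG])
      (fun x hx => by
        have := ih (hsub x hx) hx.1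
        simp only [hG] at this ⊢
        simp [this])
    have hG0 : G 0 = 0 := by simp [hG]
    have hcongr : ∀ x, g x * (G x ^ (n + 1) / (n + 1)!) + G x * (g x * (G x ^ n / n !)) =
        (n + 2 : ℝ) * (g x * (G x ^ (n + 1) / (n + 1)!)) := by
      intro x
      rw [Nat.factorial_succ]
      push_cast
      field_simp
      ring
    simp only [Pi.pow_apply, hcongr, hG0, zero_mul, sub_zero] at key
    rw [intervalIntegral.integral_const_mul] at key
    have h2 : (n + 2 : ℝ) ≠ 0 := by positivity
    have : ∫ x in (0 : ℝ)..b, g x * (G x ^ (n + 1) / (n + 1)!) =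
        G b * (G b ^ (n + 1) / (n + 1)!) / (n + 2) := by
      rw [key]; field_simp
    rw [this, Nat.factorial_succ (n + 1)]
    push_cast
    field_simp
    ring

/-- Substituting the integral inequality into itself n times, starting from the crude bound B,
leaves a remainder that vanishes as n → ∞. No sign of C is needed. -/
theorem le_partial_exp_sum_of_le_integral {w : ℝ → ℝ} {b C B : ℝ} (hb : 0 ≤ b)
    (hg : IntervalIntegrable g volume 0 b) (hg0 : ∀ x, 0 ≤ g x) (hw : ContinuousOn w (Icc 0 b))
    (hB : ∀ x ∈ Icc 0 b, w x ≤ B)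
    (h : ∀ x ∈ Icc 0 b, w x ≤ C + ∫ t in (0 : ℝ)..x, g t * w t) (n : ℕ) :
    ∀ x ∈ Icc 0 b, w x ≤ C * (∑ k ∈ Finset.range n, (∫ t in (0 : ℝ)..x, g t) ^ k / k !) +
      B * ((∫ t in (0 : ℝ)..x, g t) ^ n / n !) := by
  induction n with
  | zero => simpa using hB
  | succ n ih =>
    intro x hx
    have hsub : Icc 0 x ⊆ Icc 0 b := Icc_subset_Icc_right hx.2
    have hgx : IntervalIntegrable g volume 0 x :=
      hg.mono_set (by rwa [uIcc_of_le hx.1, uIcc_of_le hb])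
    have hGc : ContinuousOn (fun x => ∫ t in (0 : ℝ)..x, g t) (uIcc 0 x) := by
      rw [uIcc_of_le hx.1]; exact continuousOn_primitive_Icc hx.1 hgx
    have hi : ∀ k : ℕ, IntervalIntegrable (fun t => g t * ((∫ s in (0 : ℝ)..t, g s) ^ k / k !))
        volume 0 x := fun k => hgx.mul_continuousOn ((hGc.pow k).div_const _)
    have hi' : ∀ (k : ℕ) (D : ℝ), IntervalIntegrable
        (fun t => D * (g t * ((∫ s in (0 : ℝ)..t, g s) ^ k / k !))) volume 0 x :=
      fun k D => (hi k).const_mul D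
    have hs : IntervalIntegrable (fun t => ∑ k ∈ Finset.range n,
        C * (g t * ((∫ s in (0 : ℝ)..t, g s) ^ k / k !))) volume 0 x := by
      have := IntervalIntegrable.sum (Finset.range n) (fun k _ => hi' k C)
      simpa [Finset.sum_fn] using this
    calc w x ≤ C + ∫ t in (0 : ℝ)..x, g t * w t := h x hx
      _ ≤ C + ∫ t in (0 : ℝ)..x, ((∑ k ∈ Finset.range n,
          C * (g t * ((∫ s in (0 : ℝ)..t, g s) ^ k / k !))) +
          B * (g t * ((∫ s in (0 : ℝ)..t, g s) ^ n / n !))) := by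
        gcongr
        refine intervalIntegral.integral_mono_on hx.1 ?_ (hs.add (hi' n B)) fun t ht => ?_
        · exact hgx.mul_continuousOn (by rw [uIcc_of_le hx.1]; exact hw.mono hsub)
        · refine (mul_le_mul_of_nonneg_left (ih t (hsub ht)) (hg0 t)).trans_eq ?_
          rw [mul_add, Finset.mul_sum, Finset.mul_sum]
          congr 1
          · exact Finset.sum_congr rfl fun k _ => by ring
          · ring
      _ = _ := by
        rw [intervalIntegral.integral_add hs (hi' n B),
          intervalIntegral.integral_finsetSum fun k _ => hi' k C]
        simp only [intervalIntegral.integral_const_mul, integral_mul_primitive_pow hgx hx.1]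
        rw [Finset.sum_range_succ', ← Finset.mul_sum]
        simp
        ring

/-- Grönwall's inequality in integral form with an integrable coefficient. -/
theorem le_mul_exp_of_le_integral {w : ℝ → ℝ} {b C : ℝ} (hb : 0 ≤ b)
    (hg : IntervalIntegrable g volume 0 b) (hg0 : ∀ x, 0 ≤ g x) (hw : ContinuousOn w (Icc 0 b))
    (h : ∀ x ∈ Icc 0 b, w x ≤ C + ∫ t in (0 : ℝ)..x, g t * w t) :
    w b ≤ C * Real.exp (∫ t in (0 : ℝ)..b, g t) := by
  obtain ⟨B, hB⟩ := (isCompact_Icc.bddAbove_image hw)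
  have hB' : ∀ x ∈ Icc 0 b, w x ≤ B := fun x hx => hB (mem_image_of_mem w hx)
  have hlim : Tendsto (fun n : ℕ => C * (∑ k ∈ Finset.range n, (∫ t in (0 : ℝ)..b, g t) ^ k / k !) +
      B * ((∫ t in (0 : ℝ)..b, g t) ^ n / n !)) atTop
      (𝓝 (C * Real.exp (∫ t in (0 : ℝ)..b, g t) + B * 0)) := by
    refine (Tendsto.const_mul _ ?_).add
      ((FloorSemiring.tendsto_pow_div_factorial_atTop _).const_mul _)
    have := (NormedSpace.expSeries_div_hasSum_exp (𝔸 := ℝ)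
      (∫ t in (0 : ℝ)..b, g t)).tendsto_sum_nat
    rwa [← Real.exp_eq_exp_ℝ] at this
  rw [mul_zero, add_zero] at hlim
  exact ge_of_tendsto' hlim fun n =>
    le_partial_exp_sum_of_le_integral hb hg hg0 hw hB' h n b (right_mem_Icc.2 hb)

end Gronwall

/-- Transfers continuity and derivatives from compact intervals to the half-line, one-sidedly at 0.
-/
theorem Icc_zero_mem_nhdsWithin_Ici (x : ℝ) : Icc 0 (x + 1) ∈ 𝓝[Ici (0 : ℝ)] x :=
  inter_mem self_mem_nhdsWithin (mem_nhdsWithin_of_mem_nhds (Iic_mem_nhds (by linarith)))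

/-! ### Linear systems with integrable coefficients -/

section Volterra

open scoped Nat

variable {𝕜 E : Type*} [RCLike 𝕜] [NormedAddCommGroup E] [NormedSpace 𝕜 E]
  {A : ℝ → E →L[𝕜] E}

theorem intervalIntegrable_clm_apply {a b : ℝ} {Y : ℝ → E} (hA : IntervalIntegrable A volume a b)
    (hY : ContinuousOn Y (uIcc a b)) : IntervalIntegrable (fun t => A t (Y t)) volume a b := by
  rw [intervalIntegrable_iff] at hA ⊢
  obtain ⟨C, hC⟩ := isCompact_uIcc.exists_bound_of_continuousOn hY
  have hYm : AEStronglyMeasurable Y (volume.restrict (uIoc a b)) :=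
    (hY.mono uIoc_subset_uIcc).aestronglyMeasurable measurableSet_uIoc
  have hm : AEStronglyMeasurable (fun t => A t (Y t)) (volume.restrict (uIoc a b)) :=
    (isBoundedBilinearMap_apply (𝕜 := 𝕜)).continuous.comp_aestronglyMeasurable
      (hA.aestronglyMeasurable.prodMk hYm)
  refine Integrable.mono' (hA.norm.mul_const C) hm ?_
  filter_upwards [ae_restrict_mem measurableSet_uIoc] with t ht
  exact (A t).le_opNorm_of_le (hC t (uIoc_subset_uIcc ht))

variable [NormedSpace ℝ E]

/-- The terms of the Picard series of the equation `Y' = A Y`, `Y(0) = Y₀`. -/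
noncomputable def picardTerm (A : ℝ → E →L[𝕜] E) (Y₀ : E) : ℕ → ℝ → E
  | 0 => fun _ => Y₀
  | n + 1 => fun x => ∫ t in (0 : ℝ)..x, A t (picardTerm A Y₀ n t)

theorem continuous_picardTerm (hA : ∀ a b, IntervalIntegrable A volume a b) (Y₀ : E) (n : ℕ) :
    Continuous (picardTerm A Y₀ n) := by
  induction n with
  | zero => exact continuous_const
  | succ n ih =>
    exact intervalIntegral.continuous_primitive
      (fun a b => intervalIntegrable_clm_apply (hA a b) ih.continuousOn) 0

theorem norm_picardTerm_le (hA : ∀ a b, IntervalIntegrable A volume a b) (Y₀ : E) (n : ℕ) {x : ℝ}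
    (hx : 0 ≤ x) :
    ‖picardTerm A Y₀ n x‖ ≤ ‖Y₀‖ * ((∫ t in (0 : ℝ)..x, ‖A t‖) ^ n / n !) := by
  induction n generalizing x with
  | zero => simp [picardTerm]
  | succ n ih =>
    have hc : Continuous fun x => ∫ t in (0 : ℝ)..x, ‖A t‖ :=
      intervalIntegral.continuous_primitive (fun a b => (hA a b).norm) 0
    calc ‖picardTerm A Y₀ (n + 1) x‖
        ≤ ∫ t in (0 : ℝ)..x, ‖Y₀‖ * (‖A t‖ * ((∫ s in (0 : ℝ)..t, ‖A s‖) ^ n / n !)) := by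
          refine intervalIntegral.norm_integral_le_of_norm_le hx (ae_of_all _ fun t ht => ?_) ?_
          · refine ((A t).le_opNorm _).trans ?_
            rw [mul_left_comm]
            gcongr
            exact ih ht.1.le
          · exact ((hA 0 x).norm.mul_continuousOn
              ((hc.pow n).div_const _).continuousOn).const_mul _
      _ = _ := by
          rw [intervalIntegral.integral_const_mul, integral_mul_primitive_pow (hA 0 x).norm hx]

/-- The Picard series is majorized on compact intervals by an exponential series in ∫‖A‖, which
allows termwise integration by dominated convergence. -/
theorem exists_eq_add_integral [CompleteSpace E] (hA : ∀ a b, IntervalIntegrable A volume a b)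
    (Y₀ : E) :
    ∃ Y : ℝ → E, ContinuousOn Y (Ici 0) ∧
      ∀ x, 0 ≤ x → Y x = Y₀ + ∫ t in (0 : ℝ)..x, A t (Y t) := by
  set G : ℝ → ℝ := fun x => ∫ t in (0 : ℝ)..x, ‖A t‖ with hG
  have hGmono : ∀ x y, 0 ≤ x → x ≤ y → G x ≤ G y := fun x y hx hxy =>
    intervalIntegral.integral_mono_interval le_rfl hx hxy
      (ae_of_all _ fun t => norm_nonneg _) (hA 0 y).norm
  have hG0 : ∀ x, 0 ≤ x → 0 ≤ G x := fun x hx =>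
    intervalIntegral.integral_nonneg hx fun t _ => norm_nonneg _
  have hbd : ∀ T n x, x ∈ Icc 0 T → ‖picardTerm A Y₀ n x‖ ≤ ‖Y₀‖ * (G T ^ n / n !) := by
    intro T n x hx
    refine (norm_picardTerm_le hA Y₀ n hx.1).trans ?_
    have h1 := hG0 x hx.1
    have h2 := hGmono x T hx.1 hx.2
    simp only [hG] at h1 h2 ⊢
    gcongr
  have hsum : ∀ T, Summable fun n : ℕ => ‖Y₀‖ * (G T ^ n / n !) := fun T =>
    (Real.summable_pow_div_factorial (G T)).mul_left _
  have hcont : ∀ T, ContinuousOn (fun x => ∑' n, picardTerm A Y₀ n x) (Icc 0 T) := fun T =>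
    continuousOn_tsum (fun n => (continuous_picardTerm hA Y₀ n).continuousOn) (hsum T) (hbd T)
  have hhs : ∀ x, 0 ≤ x → HasSum (fun n => picardTerm A Y₀ n x) (∑' n, picardTerm A Y₀ n x) :=
    fun x hx => (Summable.of_norm_bounded (hsum x) fun n => hbd x n x ⟨hx, le_rfl⟩).hasSum
  refine ⟨fun x => ∑' n, picardTerm A Y₀ n x, fun x hx => ?_, fun x hx => ?_⟩
  · exact (hcont (x + 1) x ⟨hx, by linarith⟩).mono_of_mem_nhdsWithin
      (Icc_zero_mem_nhdsWithin_Ici x)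
  · have hint : HasSum (fun n => ∫ t in (0 : ℝ)..x, A t (picardTerm A Y₀ n t))
        (∫ t in (0 : ℝ)..x, A t (∑' n, picardTerm A Y₀ n t)) := by
      refine intervalIntegral.hasSum_integral_of_dominated_convergence
        (fun n t => ‖A t‖ * (‖Y₀‖ * (G x ^ n / n !))) (fun n => ?_) (fun n => ?_) ?_ ?_ ?_
      · exact (intervalIntegrable_iff.1 (intervalIntegrable_clm_apply (hA 0 x)
          (continuous_picardTerm hA Y₀ n).continuousOn)).aestronglyMeasurable
      · refine ae_of_all _ fun t ht => (A t).le_opNorm_of_le (hbd x n t ?_)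
        rw [uIoc_of_le hx] at ht
        exact ⟨ht.1.le, ht.2⟩
      · exact ae_of_all _ fun t _ => (hsum x).mul_left _
      · simp only [tsum_mul_left]
        exact (hA 0 x).norm.mul_const _
      · refine ae_of_all _ fun t ht => ?_
        rw [uIoc_of_le hx] at ht
        exact (A t).hasSum (hhs t ht.1.le)
    have h1 := (hhs x hx)
    -- Without its zeroth term Y₀, the Picard series is the series of integrals.
    have h2 := (hasSum_nat_add_iff' (f := fun n => picardTerm A Y₀ n x) 1).2 h1
    have h3 := h2.unique hint
    simp only [Finset.sum_range_one] at h3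
    rw [← h3]
    simp [picardTerm]

end Volterra

/-! ### Existence, uniqueness and continuous dependence -/

section Solutions

variable {𝕜 : Type*} [RCLike 𝕜] {q : ℝ → ℝ} {z : 𝕜} {y dy : ℝ → 𝕜}

/-- A real integrable coefficient, as a coefficient with values in `𝕜`. -/
theorem intervalIntegrable_ofReal_sub {a b : ℝ} (hq : IntervalIntegrable q volume a b) (z : 𝕜) :
    IntervalIntegrable (fun t => ((q t : ℝ) : 𝕜) - z) volume a b :=
  (IntervalIntegrable.sub ⟨hq.1.ofReal, hq.2.ofReal⟩ intervalIntegrable_const)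

theorem IsSolution.continuousOn (h : IsSolution q z y dy) : ContinuousOn y (Ici 0) :=
  fun x hx => (h.hasDeriv x hx).continuousWithinAt

theorem uIcc_zero_subset_Ici {x : ℝ} (hx : 0 ≤ x) : uIcc 0 x ⊆ Ici (0 : ℝ) := by
  rw [uIcc_of_le hx]; exact Icc_subset_Ici_self

theorem IsSolution.intervalIntegrable (h : IsSolution q z y dy) {x : ℝ} (hx : 0 ≤ x)
    (hq : ∀ a b, IntervalIntegrable q volume a b) :
    IntervalIntegrable (fun t => q t • y t - z * y t) volume 0 x := by
  have := (intervalIntegrable_ofReal_sub (hq 0 x) z).mul_continuousOn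
    (h.continuousOn.mono (uIcc_zero_subset_Ici hx))
  refine this.congr (fun t _ => ?_)
  simp only [RCLike.real_smul_eq_coe_mul]
  ring

theorem IsSolution.continuousOn_deriv (h : IsSolution q z y dy)
    (hq : ∀ a b, IntervalIntegrable q volume a b) : ContinuousOn dy (Ici 0) := by
  intro x hx
  have hx' : (0 : ℝ) ≤ x := hx
  have h1 := continuousOn_primitive_Icc (b := x + 1) (by linarith)
    (h.intervalIntegrable (by linarith) hq)
  have h2 : ContinuousOn dy (Icc 0 (x + 1)) :=
    (continuousOn_const.add h1).congr fun t ht => h.equation t ht.1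
  exact (h2 x ⟨hx, by linarith⟩).mono_of_mem_nhdsWithin
    (Icc_zero_mem_nhdsWithin_Ici x)

theorem IsSolution.eq_add_integral (h : IsSolution q z y dy)
    (hq : ∀ a b, IntervalIntegrable q volume a b) {x : ℝ} (hx : 0 ≤ x) :
    y x = y 0 + ∫ t in (0 : ℝ)..x, dy t := by
  have := intervalIntegral.integral_eq_sub_of_hasDerivAt_of_le hx
    (h.continuousOn.mono Icc_subset_Ici_self)
    (fun t ht => (h.hasDeriv t ht.1.le).hasDerivAt (Ici_mem_nhds ht.1))
    ((h.continuousOn_deriv hq).mono (uIcc_zero_subset_Ici hx)).intervalIntegrable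
  rw [this]
  ring

/-- The initial value problem is solvable. -/
theorem exists_isSolutionIVP (hq : ∀ a b, IntervalIntegrable q volume a b) (z a b : 𝕜) :
    ∃ y dy : ℝ → 𝕜, IsSolutionIVP q z a b y dy := by
  let N : 𝕜 × 𝕜 →L[𝕜] 𝕜 × 𝕜 :=
    (ContinuousLinearMap.inl 𝕜 𝕜 𝕜).comp (ContinuousLinearMap.snd 𝕜 𝕜 𝕜)
  let L : 𝕜 × 𝕜 →L[𝕜] 𝕜 × 𝕜 :=
    (ContinuousLinearMap.inr 𝕜 𝕜 𝕜).comp (ContinuousLinearMap.fst 𝕜 𝕜 𝕜)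
  -- The first-order system for (y, y'), with matrix rows (0, 1) and (q − z, 0).
  let A : ℝ → 𝕜 × 𝕜 →L[𝕜] 𝕜 × 𝕜 := fun t => N + ((q t : 𝕜) - z) • L
  have hA : ∀ a b, IntervalIntegrable A volume a b := fun a b => by
    have h := intervalIntegrable_ofReal_sub (hq a b) z
    exact intervalIntegrable_const.add ⟨h.1.smul_const L, h.2.smul_const L⟩
  have happ : ∀ t (v : 𝕜 × 𝕜), A t v = (v.2, ((q t : 𝕜) - z) * v.1) := fun t v => by
    simp [A, N, L]
  obtain ⟨Y, hYc, hY⟩ := exists_eq_add_integral hA (a, b)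
  have hint : ∀ x, 0 ≤ x → IntervalIntegrable (fun t => A t (Y t)) volume 0 x := fun x hx =>
    intervalIntegrable_clm_apply (hA 0 x) (hYc.mono (uIcc_zero_subset_Ici hx))
  have h1 : ∀ x, 0 ≤ x → (Y x).1 = a + ∫ t in (0 : ℝ)..x, (Y t).2 := fun x hx => by
    have := congrArg (ContinuousLinearMap.fst ℝ 𝕜 𝕜) (hY x hx)
    rw [map_add, ← ContinuousLinearMap.intervalIntegral_comp_comm _ (hint x hx)] at this
    simpa [happ] using this
  have h2 : ∀ x, 0 ≤ x → (Y x).2 = b + ∫ t in (0 : ℝ)..x, (q t • (Y t).1 - z * (Y t).1) :=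
    fun x hx => by
      have := congrArg (ContinuousLinearMap.snd ℝ 𝕜 𝕜) (hY x hx)
      rw [map_add, ← ContinuousLinearMap.intervalIntegral_comp_comm _ (hint x hx)] at this
      simpa [happ, RCLike.real_smul_eq_coe_mul, sub_mul] using this
  have h10 : (Y 0).1 = a := by simpa using h1 0 le_rfl
  have h20 : (Y 0).2 = b := by simpa using h2 0 le_rfl
  have hc2 : ContinuousOn (fun t => (Y t).2) (Ici 0) := continuous_snd.comp_continuousOn hYc
  refine ⟨fun x => (Y x).1, fun x => (Y x).2, ⟨fun x hx => ?_, fun x hx => ?_⟩, h10, h20⟩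
  · have hd : HasDerivWithinAt (fun u => ∫ t in (0 : ℝ)..u, (Y t).2) (Y x).2 (Icc 0 (x + 1)) x := by
      have : Fact (x ∈ Icc 0 (x + 1)) := ⟨hx, by linarith⟩
      exact intervalIntegral.integral_hasDerivWithinAt_right
        (hc2.mono (uIcc_zero_subset_Ici hx)).intervalIntegrable
        ((hc2.mono Icc_subset_Ici_self).stronglyMeasurableAtFilter_nhdsWithin
          measurableSet_Icc x)
        ((hc2.mono Icc_subset_Ici_self) x this.out)
    have hd' := (hd.const_add a).congr (fun t ht => h1 t ht.1) (h1 x hx)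
    exact hd'.mono_of_mem_nhdsWithin (Icc_zero_mem_nhdsWithin_Ici x)
  · rw [h20]; exact h2 x hx

/-- Continuous dependence of solutions on the initial values and the spectral parameter. -/
theorem IsSolution.norm_sub_le {z' : 𝕜} {w dw : ℝ → 𝕜} (h : IsSolution q z y dy)
    (h' : IsSolution q z' w dw) (hq : ∀ a b, IntervalIntegrable q volume a b) {b : ℝ}
    (hb : 0 ≤ b) :
    ‖y b - w b‖ + ‖dy b - dw b‖ ≤
      (‖y 0 - w 0‖ + ‖dy 0 - dw 0‖ + ‖z - z'‖ * ∫ t in (0 : ℝ)..b, ‖w t‖) *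
        Real.exp (∫ t in (0 : ℝ)..b, (1 + |q t| + ‖z‖)) := by
  have hyc := h.continuousOn
  have hwc := h'.continuousOn
  have hdyc := h.continuousOn_deriv hq
  have hdwc := h'.continuousOn_deriv hq
  have hgi : ∀ x, IntervalIntegrable (fun t => 1 + |q t| + ‖z‖) volume 0 x := fun x =>
    (intervalIntegrable_const.add (hq 0 x).norm).add intervalIntegrable_const
  have hφc : ContinuousOn (fun t => ‖y t - w t‖ + ‖dy t - dw t‖) (Ici 0) :=
    (hyc.sub hwc).norm.add (hdyc.sub hdwc).norm
  refine le_mul_exp_of_le_integral (g := fun t => 1 + |q t| + ‖z‖)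
    (w := fun t => ‖y t - w t‖ + ‖dy t - dw t‖) hb (hgi b) (fun x => by positivity)
    (hφc.mono Icc_subset_Ici_self) fun x hx => ?_
  have hx0 := hx.1
  have hsub := uIcc_zero_subset_Ici hx0
  have hwi : IntervalIntegrable (fun t => ‖w t‖) volume 0 x :=
    (hwc.norm.mono hsub).intervalIntegrable
  have i1 : IntervalIntegrable dy volume 0 x := (hdyc.mono hsub).intervalIntegrable
  have i2 : IntervalIntegrable dw volume 0 x := (hdwc.mono hsub).intervalIntegrable
  have i3 := h.intervalIntegrable hx0 hq
  have i4 := h'.intervalIntegrable hx0 hq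
  have i5 : IntervalIntegrable (fun t => ‖dy t - dw t‖) volume 0 x := (i1.sub i2).norm
  have i6 : IntervalIntegrable (fun t => (|q t| + ‖z‖) * ‖y t - w t‖ + ‖z - z'‖ * ‖w t‖)
      volume 0 x :=
    (((hq 0 x).norm.add intervalIntegrable_const).mul_continuousOn
      ((hyc.sub hwc).norm.mono hsub)).add (hwi.const_mul _)
  have e1 : ‖y x - w x‖ ≤ ‖y 0 - w 0‖ + ∫ t in (0 : ℝ)..x, ‖dy t - dw t‖ := by
    have : y x - w x = (y 0 - w 0) + ∫ t in (0 : ℝ)..x, (dy t - dw t) := by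
      rw [intervalIntegral.integral_sub i1 i2, h.eq_add_integral hq hx0,
        h'.eq_add_integral hq hx0]
      ring
    rw [this]
    exact (norm_add_le _ _).trans (by
      gcongr; exact intervalIntegral.norm_integral_le_integral_norm hx0)
  have e2 : ‖dy x - dw x‖ ≤ ‖dy 0 - dw 0‖ +
      ∫ t in (0 : ℝ)..x, ((|q t| + ‖z‖) * ‖y t - w t‖ + ‖z - z'‖ * ‖w t‖) := by
    have : dy x - dw x = (dy 0 - dw 0) +
        ∫ t in (0 : ℝ)..x, ((q t • y t - z * y t) - (q t • w t - z' * w t)) := by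
      rw [intervalIntegral.integral_sub i3 i4, h.equation x hx0, h'.equation x hx0]
      ring
    rw [this]
    refine (norm_add_le _ _).trans ?_
    gcongr
    refine intervalIntegral.norm_integral_le_of_norm_le hx0 (ae_of_all _ fun t _ => ?_) i6
    -- Split so that z − z' multiplies only w: in the continuity proof w is the fixed reference
    -- solution while z moves.
    have : (q t • y t - z * y t) - (q t • w t - z' * w t) =
        ((q t : 𝕜) - z) * (y t - w t) - (z - z') * w t := by
      simp only [RCLike.real_smul_eq_coe_mul]; ring
    rw [this]
    refine (_root_.norm_sub_le _ _).trans ?_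
    rw [norm_mul, norm_mul]
    gcongr
    exact (_root_.norm_sub_le _ _).trans (by simp)
  have e3 : ∫ t in (0 : ℝ)..x, ‖w t‖ ≤ ∫ t in (0 : ℝ)..b, ‖w t‖ :=
    intervalIntegral.integral_mono_interval le_rfl hx0 hx.2 (ae_of_all _ fun t => norm_nonneg _)
      ((hwc.norm.mono (uIcc_zero_subset_Ici hb)).intervalIntegrable)
  have i7 : IntervalIntegrable
      (fun t => (1 + |q t| + ‖z‖) * (‖y t - w t‖ + ‖dy t - dw t‖)) volume 0 x :=
    (hgi x).mul_continuousOn (hφc.mono hsub)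
  have e4 : (∫ t in (0 : ℝ)..x, ‖dy t - dw t‖) +
      (∫ t in (0 : ℝ)..x, ((|q t| + ‖z‖) * ‖y t - w t‖ + ‖z - z'‖ * ‖w t‖)) ≤
      (∫ t in (0 : ℝ)..x, (1 + |q t| + ‖z‖) * (‖y t - w t‖ + ‖dy t - dw t‖)) +
        ‖z - z'‖ * ∫ t in (0 : ℝ)..x, ‖w t‖ := by
    rw [← intervalIntegral.integral_const_mul, ← intervalIntegral.integral_add i5 i6,
      ← intervalIntegral.integral_add i7 (hwi.const_mul _)]
    refine intervalIntegral.integral_mono_on hx0 (i5.add i6) (i7.add (hwi.const_mul _))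
      fun t _ => ?_
    have p1 : 0 ≤ ‖y t - w t‖ := norm_nonneg _
    have p2 : 0 ≤ (|q t| + ‖z‖) * ‖dy t - dw t‖ := by positivity
    nlinarith
  have e5 : ‖z - z'‖ * ∫ t in (0 : ℝ)..x, ‖w t‖ ≤ ‖z - z'‖ * ∫ t in (0 : ℝ)..b, ‖w t‖ := by
    gcongr
  linarith

/-- Solutions are determined by their initial values. -/
theorem IsSolution.unique {w dw : ℝ → 𝕜} (h : IsSolution q z y dy)
    (h' : IsSolution q z w dw) (hq : ∀ a b, IntervalIntegrable q volume a b)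
    (h0 : y 0 = w 0) (h1 : dy 0 = dw 0) {x : ℝ} (hx : 0 ≤ x) : y x = w x ∧ dy x = dw x := by
  have := h.norm_sub_le h' hq hx
  simp only [h0, h1, sub_self, norm_zero, add_zero, zero_mul] at this
  have p1 := norm_nonneg (y x - w x)
  have p2 := norm_nonneg (dy x - dw x)
  exact ⟨sub_eq_zero.1 (norm_eq_zero.1 (by linarith)),
    sub_eq_zero.1 (norm_eq_zero.1 (by linarith))⟩

/-- Solutions with fixed initial values depend continuously on the spectral parameter. -/
theorem continuous_of_isSolutionIVP {a b : 𝕜} {Y dY : 𝕜 → ℝ → 𝕜}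
    (h : ∀ z, IsSolutionIVP q z a b (Y z) (dY z)) (hq : ∀ a b, IntervalIntegrable q volume a b)
    {x : ℝ} (hx : 0 ≤ x) : Continuous (fun z => Y z x) ∧ Continuous (fun z => dY z x) := by
  have key : ∀ z₀, Tendsto (fun z => ‖Y z x - Y z₀ x‖ + ‖dY z x - dY z₀ x‖) (𝓝 z₀) (𝓝 0) := by
    intro z₀
    have hlim : Tendsto (fun z : 𝕜 => (‖z - z₀‖ * ∫ t in (0 : ℝ)..x, ‖Y z₀ t‖) *
        Real.exp ((∫ t in (0 : ℝ)..x, (1 + |q t|)) + x * ‖z‖)) (𝓝 z₀) (𝓝 0) := by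
      have : Continuous (fun z : 𝕜 => (‖z - z₀‖ * ∫ t in (0 : ℝ)..x, ‖Y z₀ t‖) *
        Real.exp ((∫ t in (0 : ℝ)..x, (1 + |q t|)) + x * ‖z‖)) := by fun_prop
      simpa using this.tendsto z₀
    refine squeeze_zero (fun z => by positivity) (fun z => ?_) hlim
    have := (h z).toIsSolution.norm_sub_le (h z₀).toIsSolution hq hx
    have hi : IntervalIntegrable (fun t => 1 + |q t|) volume 0 x :=
      intervalIntegrable_const.add (hq 0 x).norm
    rw [intervalIntegral.integral_add hi intervalIntegrable_const] at this
    simpa [(h z).init, (h z₀).init, (h z).init_deriv, (h z₀).init_deriv] using this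
  constructor <;> refine continuous_iff_continuousAt.2 fun z₀ => ?_
  · refine tendsto_iff_norm_sub_tendsto_zero.2 (squeeze_zero (fun _ => norm_nonneg _)
      (fun z => ?_) (key z₀))
    have := norm_nonneg (dY z x - dY z₀ x)
    linarith
  · refine tendsto_iff_norm_sub_tendsto_zero.2 (squeeze_zero (fun _ => norm_nonneg _)
      (fun z => ?_) (key z₀))
    have := norm_nonneg (Y z x - Y z₀ x)
    linarith

end Solutions

/-! ### Monodromy matrix and Floquet solutions -/

section Monodromy

variable {𝕜 : Type*} [RCLike 𝕜] {q : ℝ → ℝ} {z : 𝕜} {y dy y₁ dy₁ y₂ dy₂ u du v dv : ℝ → 𝕜}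

theorem IsSolution.linearCombination (h₁ : IsSolution q z y₁ dy₁) (h₂ : IsSolution q z y₂ dy₂)
    (hq : ∀ a b, IntervalIntegrable q volume a b) (c d : 𝕜) :
    IsSolution q z (fun x => c * y₁ x + d * y₂ x) (fun x => c * dy₁ x + d * dy₂ x) where
  hasDeriv x hx := ((h₁.hasDeriv x hx).const_mul c).add ((h₂.hasDeriv x hx).const_mul d)
  equation x hx := by
    have : ∀ t, q t • (c * y₁ t + d * y₂ t) - z * (c * y₁ t + d * y₂ t) =
        c * (q t • y₁ t - z * y₁ t) + d * (q t • y₂ t - z * y₂ t) := fun t => by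
      simp only [RCLike.real_smul_eq_coe_mul]; ring
    simp only [this]
    rw [intervalIntegral.integral_add ((h₁.intervalIntegrable hx hq).const_mul c)
      ((h₂.intervalIntegrable hx hq).const_mul d), intervalIntegral.integral_const_mul,
      intervalIntegral.integral_const_mul, h₁.equation x hx, h₂.equation x hx]
    ring

/-- Every solution is a combination of the fundamental solutions. -/
theorem IsSolution.eq_fundamental (h : IsSolution q z y dy) (hu : IsSolutionIVP q z 1 0 u du)
    (hv : IsSolutionIVP q z 0 1 v dv) (hq : ∀ a b, IntervalIntegrable q volume a b) {x : ℝ}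
    (hx : 0 ≤ x) : y x = y 0 * u x + dy 0 * v x ∧ dy x = y 0 * du x + dy 0 * dv x :=
  h.unique (hu.toIsSolution.linearCombination hv.toIsSolution hq (y 0) (dy 0)) hq
    (by simp [hu.init, hv.init]) (by simp [hu.init_deriv, hv.init_deriv]) hx

/-- If y vanished on the period, its one-sided derivative at 0 would vanish too. This links nonzero
initial vectors to the nontriviality demanded in `IsEigenvalue`. -/
theorem IsSolution.exists_ne_zero (h : IsSolution q z y dy) {ℓ : ℝ} (hℓ : 0 < ℓ)
    (h0 : y 0 ≠ 0 ∨ dy 0 ≠ 0) : ∃ x ∈ Icc 0 ℓ, y x ≠ 0 := by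
  by_contra! hz
  have hy0 : y 0 = 0 := hz 0 ⟨le_rfl, hℓ.le⟩
  have h1 : HasDerivWithinAt y (dy 0) (Icc 0 ℓ) 0 :=
    (h.hasDeriv 0 le_rfl).mono Icc_subset_Ici_self
  have h2 : HasDerivWithinAt y 0 (Icc 0 ℓ) 0 :=
    (hasDerivWithinAt_const (0 : ℝ) (Icc 0 ℓ) (0 : 𝕜)).congr hz hy0
  have := (uniqueDiffOn_Icc hℓ 0 ⟨le_rfl, hℓ.le⟩).eq_deriv _ h1 h2
  simp_all

/-- The Wronskian of two solutions is constant. -/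
theorem IsSolution.wronskian_eq (h₁ : IsSolution q z y₁ dy₁) (h₂ : IsSolution q z y₂ dy₂)
    (hq : ∀ a b, IntervalIntegrable q volume a b) {x : ℝ} (hx : 0 ≤ x) :
    y₁ x * dy₂ x - y₂ x * dy₁ x = y₁ 0 * dy₂ 0 - y₂ 0 * dy₁ 0 := by
  have hsub := uIcc_zero_subset_Ici hx
  have i₁ := ((h₁.continuousOn_deriv hq).mono hsub).intervalIntegrable (μ := volume)
  have i₂ := ((h₂.continuousOn_deriv hq).mono hsub).intervalIntegrable (μ := volume)
  have e₁ := mul_sub_mul_eq_integral hx i₁ (h₂.intervalIntegrable hx hq)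
    (fun t ht => h₁.eq_add_integral hq ht.1) (fun t ht => h₂.equation t ht.1)
  have e₂ := mul_sub_mul_eq_integral hx i₂ (h₁.intervalIntegrable hx hq)
    (fun t ht => h₂.eq_add_integral hq ht.1) (fun t ht => h₁.equation t ht.1)
  have : (∫ t in (0 : ℝ)..x, (dy₁ t * dy₂ t + y₁ t * (q t • y₂ t - z * y₂ t))) =
      ∫ t in (0 : ℝ)..x, (dy₂ t * dy₁ t + y₂ t * (q t • y₁ t - z * y₁ t)) := by
    congr 1
    funext t
    simp only [RCLike.real_smul_eq_coe_mul]
    ring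
  linear_combination e₁ - e₂ + this

theorem wronskian_fundamental (hu : IsSolutionIVP q z 1 0 u du) (hv : IsSolutionIVP q z 0 1 v dv)
    (hq : ∀ a b, IntervalIntegrable q volume a b) {x : ℝ} (hx : 0 ≤ x) :
    u x * dv x - v x * du x = 1 := by
  rw [hu.wronskian_eq hv.toIsSolution hq hx]
  simp [hu.init, hu.init_deriv, hv.init, hv.init_deriv]

/-- Translates of solutions by a period are solutions. -/
theorem IsSolution.shift (h : IsSolution q z y dy) (hq : ∀ a b, IntervalIntegrable q volume a b)
    {ℓ : ℝ} (hℓ : 0 ≤ ℓ) (hper : Function.Periodic q ℓ) :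
    IsSolution q z (fun x => y (x + ℓ)) (fun x => dy (x + ℓ)) where
  hasDeriv x hx := by
    have h1 := h.hasDeriv (x + ℓ) (by linarith)
    have h2 := h1.scomp x (((hasDerivAt_id x).add_const ℓ).hasDerivWithinAt (s := Ici 0))
      (fun t (ht : 0 ≤ t) => show 0 ≤ t + ℓ by linarith)
    simpa [Function.comp_def] using h2
  equation x hx := by
    have hs := intervalIntegral.integral_comp_add_right (a := 0) (b := x)
      (fun t => q t • y t - z * y t) ℓ
    simp only [hper _] at hs
    have hi := h.intervalIntegrable hℓ hq
    have hi' := h.intervalIntegrable (add_nonneg hx hℓ) hq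
    simp only [zero_add] at hs ⊢
    rw [hs, h.equation (x + ℓ) (by linarith), h.equation ℓ hℓ, add_assoc,
      intervalIntegral.integral_add_adjacent_intervals hi (hi.symm.trans hi')]

theorem IsSolution.floquet (h : IsSolution q z y dy) (hq : ∀ a b, IntervalIntegrable q volume a b)
    {ℓ : ℝ} (hℓ : 0 ≤ ℓ) (hper : Function.Periodic q ℓ) {ρ : 𝕜} (h0 : y ℓ = ρ * y 0)
    (h1 : dy ℓ = ρ * dy 0) {x : ℝ} (hx : 0 ≤ x) : y (x + ℓ) = ρ * y x := by
  have := ((h.shift hq hℓ hper).unique (h.linearCombination h hq ρ 0) hq (by simpa using h0)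
    (by simpa using h1) hx).1
  simpa using this

/-- A root of the characteristic polynomial of a `2 × 2` matrix has an eigenvector. -/
theorem exists_eigenvector {K : Type*} [Field K] {a b c d ρ : K} (h : (ρ - a) * (ρ - d) = b * c) :
    ∃ p r : K, (p ≠ 0 ∨ r ≠ 0) ∧ p * a + r * b = ρ * p ∧ p * c + r * d = ρ * r := by
  -- The candidates are, up to sign, the columns of the adjugate of the matrix minus ρ; if both
  -- vanish, the matrix is ρ times the identity.
  by_cases hb : b ≠ 0 ∨ ρ - a ≠ 0
  · exact ⟨b, ρ - a, hb, by ring, by linear_combination -h⟩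
  by_cases hc : ρ - d ≠ 0 ∨ c ≠ 0
  · exact ⟨ρ - d, c, hc, by linear_combination -h, by ring⟩
  push Not at hb hc
  exact ⟨1, 0, by simp, by linear_combination -hb.2, by linear_combination hc.2⟩

theorem charpoly_eq_zero_of_eigenvector {K : Type*} [Field K] {a b c d ρ p r : K}
    (hdet : a * d - b * c = 1) (hne : p ≠ 0 ∨ r ≠ 0) (h1 : p * a + r * b = ρ * p)
    (h2 : p * c + r * d = ρ * r) : ρ ^ 2 - (a + d) * ρ + 1 = 0 := by
  rcases hne with hp | hr
  · refine mul_left_cancel₀ hp ?_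
    linear_combination (d - ρ) * h1 - b * h2 - p * hdet
  · refine mul_left_cancel₀ hr ?_
    linear_combination (a - ρ) * h2 - c * h1 - r * hdet

/-- For each root of the characteristic polynomial of the monodromy matrix there is a Floquet
solution. -/
theorem exists_floquet (hu : IsSolutionIVP q z 1 0 u du) (hv : IsSolutionIVP q z 0 1 v dv)
    (hq : ∀ a b, IntervalIntegrable q volume a b) {ℓ : ℝ} (hℓ : 0 ≤ ℓ) {ρ : 𝕜}
    (hρ : ρ ^ 2 - (u ℓ + dv ℓ) * ρ + 1 = 0) :
    ∃ y dy : ℝ → 𝕜, IsSolution q z y dy ∧ (y 0 ≠ 0 ∨ dy 0 ≠ 0) ∧ y ℓ = ρ * y 0 ∧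
      dy ℓ = ρ * dy 0 := by
  have hdet := wronskian_fundamental hu hv hq hℓ
  obtain ⟨p, r, hne, h1, h2⟩ := exists_eigenvector (a := u ℓ) (b := v ℓ) (c := du ℓ) (d := dv ℓ)
    (ρ := ρ) (by linear_combination hρ + hdet)
  refine ⟨_, _, hu.toIsSolution.linearCombination hv.toIsSolution hq p r, ?_, ?_, ?_⟩ <;>
  simpa [hu.init, hu.init_deriv, hv.init, hv.init_deriv]

theorem IsSolution.charpoly_eq_zero (h : IsSolution q z y dy) (hu : IsSolutionIVP q z 1 0 u du)
    (hv : IsSolutionIVP q z 0 1 v dv) (hq : ∀ a b, IntervalIntegrable q volume a b) {ℓ : ℝ}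
    (hℓ : 0 ≤ ℓ) {ρ : 𝕜} (hne : y 0 ≠ 0 ∨ dy 0 ≠ 0) (h0 : y ℓ = ρ * y 0) (h1 : dy ℓ = ρ * dy 0) :
    ρ ^ 2 - (u ℓ + dv ℓ) * ρ + 1 = 0 := by
  obtain ⟨e1, e2⟩ := h.eq_fundamental hu hv hq hℓ
  exact charpoly_eq_zero_of_eigenvector (wronskian_fundamental hu hv hq hℓ) hne (e1 ▸ h0)
    (e2 ▸ h1)

theorem IsSolution.ofReal {lam : ℝ} {y dy : ℝ → ℝ} (h : IsSolution q lam y dy) :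
    IsSolution q (lam : ℂ) (fun x => (y x : ℂ)) (fun x => (dy x : ℂ)) where
  hasDeriv x hx := by
    have := (h.hasDeriv x hx).ofReal_comp
    exact this
  equation x hx := by
    rw [h.equation x hx]
    push_cast
    rw [← intervalIntegral.integral_ofReal]
    simp

theorem IsSolutionIVP.ofReal {lam a b : ℝ} {y dy : ℝ → ℝ} (h : IsSolutionIVP q lam a b y dy) :
    IsSolutionIVP q (lam : ℂ) (a : ℂ) (b : ℂ) (fun x => (y x : ℂ)) (fun x => (dy x : ℂ)) :=
  ⟨h.toIsSolution.ofReal, by simp [h.init], by simp [h.init_deriv]⟩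

end Monodromy

/-! ### Hill's discriminant -/

section Discriminant

variable {q u du v dv : ℝ → ℝ} {ℓ lam : ℝ}

/-- Periodic and semi-periodic eigenvalues in terms of Hill's discriminant. -/
theorem isEigenvalue_iff (hq : ∀ a b, IntervalIntegrable q volume a b) (hℓ : 0 < ℓ)
    (hu : IsSolutionIVP q lam 1 0 u du) (hv : IsSolutionIVP q lam 0 1 v dv) {s : ℝ}
    (hs : s ^ 2 = 1) : IsEigenvalue q ℓ s lam ↔ u ℓ + dv ℓ = 2 * s := by
  constructor
  · rintro ⟨y, dy, hy, ⟨x, hx, hne⟩, h0, h1⟩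
    have hinit : y 0 ≠ 0 ∨ dy 0 ≠ 0 := by
      by_contra! hc
      refine hne ?_
      rw [(hy.eq_fundamental hu hv hq hx.1).1, hc.1, hc.2]
      simp
    -- Since s is its own inverse, the boundary condition makes s a multiplier, and s² − Ds + 1 = 0
    -- reads D = 2s.
    have := hy.charpoly_eq_zero hu hv hq hℓ.le hinit (ρ := s)
      (by linear_combination (-s) * h0 - y ℓ * hs) (by linear_combination (-s) * h1 - dy ℓ * hs)
    linear_combination (-s) * this + (s - (u ℓ + dv ℓ)) * hs
  · intro htr
    obtain ⟨y, dy, hy, hne, h0, h1⟩ := exists_floquet hu hv hq hℓ.le (ρ := s)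
      (by rw [htr]; linear_combination -hs)
    exact ⟨y, dy, hy, hy.exists_ne_zero hℓ hne, by linear_combination (-s) * h0 - y 0 * hs,
      by linear_combination (-s) * h1 - dy 0 * hs⟩

/-- In a stability interval, Hill's discriminant takes values in `(-2, 2)`. -/
theorem discriminant_sq_lt (hq : ∀ a b, IntervalIntegrable q volume a b) (hℓ : 0 < ℓ) {a b : ℝ}
    (hab : IsStabilityInterval q ℓ a b) (hlam : lam ∈ Ioo a b)
    (hu : IsSolutionIVP q lam 1 0 u du) (hv : IsSolutionIVP q lam 0 1 v dv) :
    0 < 4 - (u ℓ + dv ℓ) ^ 2 := by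
  choose U dU hU using fun t : ℝ => exists_isSolutionIVP hq t 1 0
  choose V dV hV using fun t : ℝ => exists_isSolutionIVP hq t 0 1
  set D : ℝ → ℝ := fun t => U t ℓ + dV t ℓ with hD
  have hDc : Continuous D := (continuous_of_isSolutionIVP hU hq hℓ.le).1.add
    (continuous_of_isSolutionIVP hV hq hℓ.le).2
  have hper : ∀ t, IsPeriodicEigenvalue q ℓ t ↔ D t = 2 := fun t => by
    simpa [IsPeriodicEigenvalue, hD] using
      isEigenvalue_iff hq hℓ (hU t) (hV t) (s := 1) (by norm_num)
  have hsemi : ∀ t, IsSemiperiodicEigenvalue q ℓ t ↔ D t = -2 := fun t => by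
    simpa [IsSemiperiodicEigenvalue, hD] using
      isEigenvalue_iff hq hℓ (hU t) (hV t) (s := -1) (by norm_num)
  obtain ⟨hlt, hends, hno⟩ := hab
  simp only [hper, hsemi] at hends hno
  have hDlam : D lam = u ℓ + dv ℓ := by
    rw [hD]
    simp only
    rw [((hU lam).unique hu.toIsSolution hq (by rw [(hU lam).init, hu.init])
      (by rw [(hU lam).init_deriv, hu.init_deriv]) hℓ.le).1,
      ((hV lam).unique hv.toIsSolution hq (by rw [(hV lam).init, hv.init])
      (by rw [(hV lam).init_deriv, hv.init_deriv]) hℓ.le).2]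
  rw [← hDlam]
  have hcc : ∀ s : Set ℝ, ContinuousOn D s := fun s => hDc.continuousOn
  have hne := hno lam hlam
  -- Otherwise D would take the value 2 strictly between λ and the endpoint where D = −2.
  have h1 : D lam < 2 := by
    by_contra! hge
    have hgt : 2 < D lam := lt_of_le_of_ne hge (Ne.symm hne.1)
    rcases hends with ⟨-, hb⟩ | ⟨ha, -⟩
    · obtain ⟨t, ht, hDt⟩ := intermediate_value_Ioo' hlam.2.le (hcc _)
        (show (2 : ℝ) ∈ Ioo (D b) (D lam) from ⟨by rw [hb]; norm_num, hgt⟩)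
      exact (hno t ⟨hlam.1.trans ht.1, ht.2⟩).1 hDt
    · obtain ⟨t, ht, hDt⟩ := intermediate_value_Ioo hlam.1.le (hcc _)
        (show (2 : ℝ) ∈ Ioo (D a) (D lam) from ⟨by rw [ha]; norm_num, hgt⟩)
      exact (hno t ⟨ht.1, ht.2.trans hlam.2⟩).1 hDt
  have h2 : -2 < D lam := by
    by_contra! hge
    have hgt : D lam < -2 := lt_of_le_of_ne hge hne.2
    rcases hends with ⟨ha, -⟩ | ⟨-, hb⟩
    · obtain ⟨t, ht, hDt⟩ := intermediate_value_Ioo' hlam.1.le (hcc _)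
        (show (-2 : ℝ) ∈ Ioo (D lam) (D a) from ⟨hgt, by rw [ha]; norm_num⟩)
      exact (hno t ⟨ht.1, ht.2.trans hlam.2⟩).2 hDt
    · obtain ⟨t, ht, hDt⟩ := intermediate_value_Ioo hlam.2.le (hcc _)
        (show (-2 : ℝ) ∈ Ioo (D lam) (D b) from ⟨hgt, by rw [hb]; norm_num⟩)
      exact (hno t ⟨hlam.1.trans ht.1, ht.2⟩).2 hDt
  nlinarith

end Discriminant

/-! ### Square integrable Floquet solutions and the m-function -/

section Weyl

open ComplexConjugate

variable {q : ℝ → ℝ} {z : ℂ} {y dy u du v dv : ℝ → ℂ} {ℓ : ℝ}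

/-- Green's identity. -/
theorem IsSolution.im_mul_integral_norm_sq (h : IsSolution q z y dy)
    (hq : ∀ a b, IntervalIntegrable q volume a b) {x : ℝ} (hx : 0 ≤ x) :
    z.im * ∫ t in (0 : ℝ)..x, ‖y t‖ ^ 2 = (conj (y 0) * dy 0).im - (conj (y x) * dy x).im := by
  have hsub := uIcc_zero_subset_Ici hx
  have hdc : ContinuousOn (fun t => conj (dy t)) (uIcc 0 x) :=
    Complex.continuous_conj.comp_continuousOn ((h.continuousOn_deriv hq).mono hsub)
  have hyc : ContinuousOn (fun t => conj (y t)) (uIcc 0 x) :=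
    Complex.continuous_conj.comp_continuousOn (h.continuousOn.mono hsub)
  have hi := h.intervalIntegrable hx hq
  have key := mul_sub_mul_eq_integral (F := fun t => conj (y t)) hx
    hdc.intervalIntegrable hi
    (fun t ht => by
      have hd : IntervalIntegrable dy volume 0 t :=
        ((h.continuousOn_deriv hq).mono (uIcc_zero_subset_Ici ht.1)).intervalIntegrable
      have := Complex.conjCLE.toContinuousLinearMap.intervalIntegral_comp_comm hd
      rw [h.eq_add_integral hq ht.1, map_add]
      congr 1
      exact this.symm)
    (fun t ht => h.equation t ht.1)
  have hint : IntervalIntegrable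
      (fun t => conj (dy t) * dy t + conj (y t) * (q t • y t - z * y t)) volume 0 x :=
    ((hdc.mul ((h.continuousOn_deriv hq).mono hsub)).intervalIntegrable).add
      (hi.continuousOn_mul hyc)
  have him := congrArg Complex.imCLM key
  rw [← ContinuousLinearMap.intervalIntegral_comp_comm _ hint] at him
  -- The terms |y'|² and q|y|² are real, so only the spectral parameter contributes.
  have : ∀ t, Complex.imCLM (conj (dy t) * dy t + conj (y t) * (q t • y t - z * y t)) =
      -z.im * ‖y t‖ ^ 2 := fun t => by
    rw [← Complex.normSq_eq_norm_sq, Complex.normSq_apply]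
    simp
    ring
  simp only [this, intervalIntegral.integral_const_mul, map_sub, Complex.imCLM_apply] at him
  linear_combination him

theorem IsSolution.integral_norm_sq_pos (h : IsSolution q z y dy) (hℓ : 0 < ℓ)
    (hne : y 0 ≠ 0 ∨ dy 0 ≠ 0) : 0 < ∫ t in (0 : ℝ)..ℓ, ‖y t‖ ^ 2 := by
  obtain ⟨x, hx, hy⟩ := h.exists_ne_zero hℓ hne
  exact intervalIntegral.integral_pos hℓ
    ((h.continuousOn.mono Icc_subset_Ici_self).norm.pow 2) (fun t _ => by positivity)
    ⟨x, hx, by positivity⟩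

/-- For a nontrivial Floquet solution with multiplier `ρ`, `Im z` has the sign of
`(1 - |ρ|²) Im (conj y(0) y'(0))`. -/
theorem IsSolution.floquet_sign (h : IsSolution q z y dy)
    (hq : ∀ a b, IntervalIntegrable q volume a b) (hℓ : 0 < ℓ) (hne : y 0 ≠ 0 ∨ dy 0 ≠ 0) {ρ : ℂ}
    (h0 : y ℓ = ρ * y 0) (h1 : dy ℓ = ρ * dy 0) :
    ∃ c : ℝ, 0 < c ∧ z.im * c = (1 - ‖ρ‖ ^ 2) * (conj (y 0) * dy 0).im := by
  refine ⟨_, h.integral_norm_sq_pos hℓ hne, ?_⟩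
  rw [h.im_mul_integral_norm_sq hq hℓ.le, h0, h1]
  have : conj (ρ * y 0) * (ρ * dy 0) = ((‖ρ‖ ^ 2 : ℝ) : ℂ) * (conj (y 0) * dy 0) := by
    rw [map_mul, Complex.ofReal_pow, ← Complex.conj_mul']
    ring
  rw [this, Complex.im_ofReal_mul]
  ring

theorem IsSolution.floquet_iterate (h : IsSolution q z y dy)
    (hq : ∀ a b, IntervalIntegrable q volume a b) (hℓ : 0 ≤ ℓ) (hper : Function.Periodic q ℓ)
    {ρ : ℂ} (h0 : y ℓ = ρ * y 0) (h1 : dy ℓ = ρ * dy 0) (n : ℕ) {x : ℝ} (hx : 0 ≤ x) :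
    y (x + n * ℓ) = ρ ^ n * y x := by
  induction n with
  | zero => simp
  | succ n ih =>
    have : x + (n + 1 : ℕ) * ℓ = (x + n * ℓ) + ℓ := by push_cast; ring
    rw [this, h.floquet hq hℓ hper h0 h1 (by positivity), ih]
    ring

theorem IsSolution.aestronglyMeasurable (h : IsSolution q z y dy) :
    AEStronglyMeasurable y (volume.restrict (Ioi 0)) :=
  (h.continuousOn.mono Ioi_subset_Ici_self).aestronglyMeasurable measurableSet_Ioi

/-- Floquet solutions with multiplier inside the unit disc are square integrable. -/
theorem IsSolution.memLp_of_floquet (h : IsSolution q z y dy)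
    (hq : ∀ a b, IntervalIntegrable q volume a b) (hℓ : 0 < ℓ) (hper : Function.Periodic q ℓ)
    {ρ : ℂ} (hρ0 : ρ ≠ 0) (hρ : ‖ρ‖ < 1) (h0 : y ℓ = ρ * y 0) (h1 : dy ℓ = ρ * dy 0) :
    MemLp y 2 (volume.restrict (Ioi 0)) := by
  rw [memLp_two_iff_integrable_sq_norm h.aestronglyMeasurable]
  obtain ⟨C, hC⟩ := (isCompact_Icc (a := (0 : ℝ)) (b := ℓ)).exists_bound_of_continuousOn
    (h.continuousOn.mono Icc_subset_Ici_self)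
  have hpos : 0 < ‖ρ‖ := norm_pos_iff.2 hρ0
  have hlog : Real.log ‖ρ‖ < 0 := Real.log_neg hpos hρ
  -- The decay rate with exp(aℓ) = |ρ|². The factor exp(−aℓ) below pays for the incomplete last
  -- period.
  set a : ℝ := 2 * Real.log ‖ρ‖ / ℓ with ha
  have ha0 : a < 0 := div_neg_of_neg_of_pos (by linarith) hℓ
  have hexp : Integrable (fun x => C ^ 2 * Real.exp (-(a * ℓ)) * Real.exp (a * x))
      (volume.restrict (Ioi 0)) := (integrableOn_exp_mul_Ioi ha0 0).const_mul _
  refine hexp.mono' (h.aestronglyMeasurable.norm.pow 2) ?_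
  filter_upwards [ae_restrict_mem measurableSet_Ioi] with x hx
  have hx0 : 0 ≤ x := le_of_lt hx
  set n := ⌊x / ℓ⌋₊ with hn
  have hn1 : n * ℓ ≤ x := by
    have := Nat.floor_le (div_nonneg hx0 hℓ.le)
    rwa [le_div_iff₀ hℓ] at this
  have hn2 : x < (n + 1) * ℓ := by
    have := Nat.lt_floor_add_one (x / ℓ)
    rwa [div_lt_iff₀ hℓ] at this
  have hy : y x = ρ ^ n * y (x - n * ℓ) := by
    rw [← h.floquet_iterate hq hℓ.le hper h0 h1 n (by linarith)]
    congr 1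
    ring
  have hyC : ‖y (x - n * ℓ)‖ ≤ C := hC _ ⟨by linarith, by linarith⟩
  rw [Real.norm_of_nonneg (by positivity), hy, norm_mul, norm_pow, mul_pow]
  have hρn : (‖ρ‖ ^ n) ^ 2 ≤ Real.exp (-(a * ℓ)) * Real.exp (a * x) := by
    rw [← Real.exp_add, ← pow_mul, ← Real.exp_log hpos, ← Real.exp_nat_mul, Real.exp_le_exp]
    have : a * ℓ = 2 * Real.log ‖ρ‖ := by rw [ha]; field_simp
    push_cast
    have h3 : n * (a * ℓ) ≤ a * (x - ℓ) := by nlinarith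
    rw [this] at h3
    linarith
  calc (‖ρ‖ ^ n) ^ 2 * ‖y (x - n * ℓ)‖ ^ 2 ≤
      (Real.exp (-(a * ℓ)) * Real.exp (a * x)) * C ^ 2 := by gcongr
    _ = _ := by ring

/-- Nontrivial Floquet solutions with multiplier outside the closed unit disc are not square
integrable. -/
theorem IsSolution.not_memLp_of_floquet (h : IsSolution q z y dy)
    (hq : ∀ a b, IntervalIntegrable q volume a b) (hℓ : 0 < ℓ) (hper : Function.Periodic q ℓ)
    (hne : y 0 ≠ 0 ∨ dy 0 ≠ 0) {ρ : ℂ} (hρ : 1 < ‖ρ‖) (h0 : y ℓ = ρ * y 0)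
    (h1 : dy ℓ = ρ * dy 0) : ¬ MemLp y 2 (volume.restrict (Ioi 0)) := by
  intro hL
  rw [memLp_two_iff_integrable_sq_norm h.aestronglyMeasurable] at hL
  have hpos := h.integral_norm_sq_pos hℓ hne
  rw [intervalIntegral.integral_of_le hℓ.le] at hpos
  have hle : ∫ t in Ioc 0 ℓ, ‖y t‖ ^ 2 ≤ ∫ t in Ioi 0, ‖y t‖ ^ 2 :=
    setIntegral_mono_set hL (ae_of_all _ fun t => by positivity)
      (Ioc_subset_Ioi_self.eventuallyLE)
  have hle' : ∫ t in Ioi ℓ, ‖y t‖ ^ 2 ≤ ∫ t in Ioi 0, ‖y t‖ ^ 2 :=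
    setIntegral_mono_set hL (ae_of_all _ fun t => by positivity)
      ((Ioi_subset_Ioi hℓ.le).eventuallyLE)
  -- Translation by ℓ multiplies the positive total integral by |ρ|² > 1, yet gives only the part
  -- over (ℓ, ∞).
  have hshift : ∫ t in Ioi 0, ‖y (t + ℓ)‖ ^ 2 = ∫ t in Ioi ℓ, ‖y t‖ ^ 2 := by
    have := (measurePreserving_add_right volume ℓ).setIntegral_preimage_emb
      (measurableEmbedding_addRight ℓ) (fun t => ‖y t‖ ^ 2) (Ioi ℓ)
    simpa using this
  have hmul : ∫ t in Ioi 0, ‖y (t + ℓ)‖ ^ 2 = ‖ρ‖ ^ 2 * ∫ t in Ioi 0, ‖y t‖ ^ 2 := by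
    rw [← integral_const_mul]
    refine setIntegral_congr_fun measurableSet_Ioi fun t ht => ?_
    rw [h.floquet hq hℓ.le hper h0 h1 (le_of_lt ht), norm_mul, mul_pow]
  have hI : 0 < ∫ t in Ioi 0, ‖y t‖ ^ 2 := hpos.trans_le hle
  have hlt : ∫ t in Ioi 0, ‖y t‖ ^ 2 < ‖ρ‖ ^ 2 * ∫ t in Ioi 0, ‖y t‖ ^ 2 :=
    lt_mul_of_one_lt_left hI (one_lt_pow₀ hρ two_ne_zero)
  linarith

/-- The square integrable Floquet solution and its relation to the Titchmarsh-Weyl coefficient. -/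
theorem exists_weyl_floquet (hq : ∀ a b, IntervalIntegrable q volume a b) (hℓ : 0 < ℓ)
    (hper : Function.Periodic q ℓ) (α : ℝ) (hz : z.im ≠ 0)
    (hu : IsSolutionIVP q z 1 0 u du) (hv : IsSolutionIVP q z 0 1 v dv) :
    ∃ m ρ : ℂ, IsTitchmarshWeyl q α z m ∧ (∀ m', IsTitchmarshWeyl q α z m' → m' = m) ∧
      0 < z.im * m.im ∧ ρ ^ 2 - (u ℓ + dv ℓ) * ρ + 1 = 0 ∧
      u ℓ * (Real.cos α - m * Real.sin α) + v ℓ * (Real.sin α + m * Real.cos α) =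
        ρ * (Real.cos α - m * Real.sin α) ∧
      du ℓ * (Real.cos α - m * Real.sin α) + dv ℓ * (Real.sin α + m * Real.cos α) =
        ρ * (Real.sin α + m * Real.cos α) := by
  have hroot : ∀ ρ : ℂ, ρ ^ 2 - (u ℓ + dv ℓ) * ρ + 1 = 0 → ‖ρ‖ ≠ 1 := fun ρ hρ hn => by
    obtain ⟨y, dy, hy, hne, h0, h1⟩ := exists_floquet hu hv hq hℓ.le hρ
    obtain ⟨c, hc, e⟩ := hy.floquet_sign hq hℓ hne h0 h1
    rw [hn] at e
    have : z.im * c = 0 := by rw [e]; ring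
    exact (mul_ne_zero hz hc.ne') this
  obtain ⟨ρ, ρ', hρ, hρ', hlt, hgt⟩ : ∃ ρ ρ' : ℂ, ρ ^ 2 - (u ℓ + dv ℓ) * ρ + 1 = 0 ∧
      ρ' ^ 2 - (u ℓ + dv ℓ) * ρ' + 1 = 0 ∧ ‖ρ‖ < 1 ∧ 1 < ‖ρ'‖ := by
    -- The two roots have product 1 and neither has modulus 1, so the unit circle separates them.
    obtain ⟨s, hs⟩ := IsAlgClosed.exists_pow_nat_eq ((u ℓ + dv ℓ) ^ 2 - 4) two_pos
    have r₁ : ((u ℓ + dv ℓ + s) / 2) ^ 2 - (u ℓ + dv ℓ) * ((u ℓ + dv ℓ + s) / 2) + 1 = 0 := by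
      linear_combination hs / 4
    have r₂ : ((u ℓ + dv ℓ - s) / 2) ^ 2 - (u ℓ + dv ℓ) * ((u ℓ + dv ℓ - s) / 2) + 1 = 0 := by
      linear_combination hs / 4
    have hprod : ‖(u ℓ + dv ℓ + s) / 2‖ * ‖(u ℓ + dv ℓ - s) / 2‖ = 1 := by
      rw [← norm_mul, show (u ℓ + dv ℓ + s) / 2 * ((u ℓ + dv ℓ - s) / 2) = 1 by
        linear_combination -hs / 4, norm_one]
    have p₁ := norm_nonneg ((u ℓ + dv ℓ + s) / 2)
    have p₂ := norm_nonneg ((u ℓ + dv ℓ - s) / 2)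
    rcases lt_or_gt_of_ne (hroot _ r₁) with hl | hl
    · exact ⟨_, _, r₁, r₂, hl, by nlinarith⟩
    · exact ⟨_, _, r₂, r₁, by nlinarith, hl⟩
  have hρ0 : ρ ≠ 0 := by rintro rfl; simp at hρ
  have hcs : (Real.cos α : ℂ) ^ 2 + (Real.sin α : ℂ) ^ 2 = 1 := by
    exact_mod_cast Real.cos_sq_add_sin_sq α
  obtain ⟨y, dy, hy, hne, h0, h1⟩ := exists_floquet hu hv hq hℓ.le hρ
  -- Coordinates of the initial vector in the orthonormal basis of the data of θ and φ: y = kθ + tφ,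
  -- whence m = t/k.
  set k : ℂ := y 0 * Real.cos α + dy 0 * Real.sin α with hk
  set t : ℂ := dy 0 * Real.cos α - y 0 * Real.sin α with ht
  have hy0 : y 0 = k * Real.cos α - t * Real.sin α := by
    rw [hk, ht]; linear_combination (-y 0) * hcs
  have hdy0 : dy 0 = k * Real.sin α + t * Real.cos α := by
    rw [hk, ht]; linear_combination (-dy 0) * hcs
  -- Otherwise y is a multiple of φ, whose data are real, and Green's identity would give Im z = 0.
  have hk0 : k ≠ 0 := by
    intro hk0
    obtain ⟨c, hc, e⟩ := hy.floquet_sign hq hℓ hne h0 h1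
    have : (conj (y 0) * dy 0).im = 0 := by
      rw [hy0, hdy0, hk0]
      simp only [zero_mul, zero_sub, zero_add, map_neg, map_mul, Complex.conj_ofReal]
      simp
      ring
    rw [this, mul_zero] at e
    exact (mul_ne_zero hz hc.ne') e
  obtain ⟨θ, dθ, hθ⟩ := exists_isSolutionIVP hq z (Real.cos α : ℂ) (Real.sin α : ℂ)
  obtain ⟨φ, dφ, hφ⟩ := exists_isSolutionIVP hq z (-(Real.sin α : ℂ)) (Real.cos α : ℂ)
  set m : ℂ := t / k with hm
  have hS := hθ.toIsSolution.linearCombination hφ.toIsSolution hq 1 m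
  set S : ℝ → ℂ := fun x => 1 * θ x + m * φ x with hSdef
  set dS : ℝ → ℂ := fun x => 1 * dθ x + m * dφ x with hdSdef
  have hS0 : S 0 = Real.cos α - m * Real.sin α := by
    simp only [hSdef, hθ.init, hφ.init]; ring
  have hdS0 : dS 0 = Real.sin α + m * Real.cos α := by
    simp only [hdSdef, hθ.init_deriv, hφ.init_deriv]; ring
  have hyS0 : S 0 = k⁻¹ * y 0 := by rw [hS0, hy0, hm]; field_simp
  have hydS0 : dS 0 = k⁻¹ * dy 0 := by rw [hdS0, hdy0, hm]; field_simp
  have hSy := hS.unique (hy.linearCombination hy hq k⁻¹ 0) hq (by simpa using hyS0)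
    (by simpa using hydS0) hℓ.le
  simp only [zero_mul, add_zero] at hSy
  have hSℓ : S ℓ = ρ * S 0 := by rw [hSy.1, hyS0, h0]; ring
  have hdSℓ : dS ℓ = ρ * dS 0 := by rw [hSy.2, hydS0, h1]; ring
  have hSne : S 0 ≠ 0 ∨ dS 0 ≠ 0 := by
    rw [hyS0, hydS0]
    exact hne.imp (mul_ne_zero (inv_ne_zero hk0)) (mul_ne_zero (inv_ne_zero hk0))
  have hSL : MemLp S 2 (volume.restrict (Ioi 0)) :=
    hS.memLp_of_floquet hq hℓ hper hρ0 hlt hSℓ hdSℓ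
  refine ⟨m, ρ, ⟨θ, dθ, φ, dφ, hθ, hφ, by simpa [hSdef] using hSL⟩, ?_, ?_, hρ, ?_, ?_⟩
  · rintro m' ⟨θ', dθ', φ', dφ', hθ', hφ', hL⟩
    -- Two coefficients would put φ, then θ, then every solution in L², including the growing
    -- Floquet solution.
    by_contra hmm
    have hLc : MemLp (fun x => θ x + m' * φ x) 2 (volume.restrict (Ioi 0)) := by
      refine hL.ae_eq ((ae_restrict_iff' measurableSet_Ioi).2 (ae_of_all _ fun x hx => ?_))
      simp only
      rw [(hθ'.unique hθ.toIsSolution hq (by rw [hθ'.init, hθ.init])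
        (by rw [hθ'.init_deriv, hθ.init_deriv]) (le_of_lt hx)).1,
        (hφ'.unique hφ.toIsSolution hq (by rw [hφ'.init, hφ.init])
        (by rw [hφ'.init_deriv, hφ.init_deriv]) (le_of_lt hx)).1]
    have hd : m' - m ≠ 0 := sub_ne_zero.2 hmm
    have hφL : MemLp φ 2 (volume.restrict (Ioi 0)) := by
      refine ((hLc.sub hSL).const_mul (m' - m)⁻¹).ae_eq (ae_of_all _ fun x => ?_)
      simp only [Pi.sub_apply, hSdef]
      field_simp
      ring
    have hθL : MemLp θ 2 (volume.restrict (Ioi 0)) := by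
      refine (hSL.sub (hφL.const_mul m)).ae_eq (ae_of_all _ fun x => ?_)
      simp [hSdef]
    obtain ⟨w, dw, hw, hwne, w0, w1⟩ := exists_floquet hu hv hq hℓ.le hρ'
    refine hw.not_memLp_of_floquet hq hℓ hper hwne hgt w0 w1 ?_
    refine ((hθL.const_mul (w 0 * Real.cos α + dw 0 * Real.sin α)).add
      (hφL.const_mul (dw 0 * Real.cos α - w 0 * Real.sin α))).ae_eq
      ((ae_restrict_iff' measurableSet_Ioi).2 (ae_of_all _ fun x hx => ?_))
    refine ((hw.unique (hθ.toIsSolution.linearCombination hφ.toIsSolution hq _ _) hq ?_ ?_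
      (le_of_lt hx)).1).symm
    · rw [hθ.init, hφ.init]; linear_combination (-w 0) * hcs
    · rw [hθ.init_deriv, hφ.init_deriv]; linear_combination (-dw 0) * hcs
  · obtain ⟨c, hc, e⟩ := hS.floquet_sign hq hℓ hSne hSℓ hdSℓ
    have him : (conj (S 0) * dS 0).im = m.im := by
      rw [hS0, hdS0]
      simp [-Complex.ofReal_cos, -Complex.ofReal_sin]
      linear_combination m.im * Real.cos_sq_add_sin_sq α
    rw [him] at e
    have hρ1 : 0 < 1 - ‖ρ‖ ^ 2 := by nlinarith [norm_nonneg ρ]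
    have hzz : 0 < z.im ^ 2 * c := by positivity
    have : z.im ^ 2 * c = (1 - ‖ρ‖ ^ 2) * (z.im * m.im) := by linear_combination z.im * e
    rw [this] at hzz
    exact pos_of_mul_pos_right hzz hρ1.le
  · have := (hS.eq_fundamental hu hv hq hℓ.le).1
    rw [hSℓ, hS0, hdS0] at this
    linear_combination -this
  · have := (hS.eq_fundamental hu hv hq hℓ.le).2
    rw [hdSℓ, hS0, hdS0] at this
    linear_combination -this

end Weyl

/-! ### Boundary values of the m-function and the spectral density -/

/-- If `w² → -K²` and `w` stays above the line `Im = -K/2`, then `Im w → K`. -/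
theorem tendsto_im_of_tendsto_sq {ι : Type*} {l : Filter ι} {w : ι → ℂ} {K : ℝ} (hK : 0 < K)
    (hw : Tendsto (fun i => w i ^ 2) l (𝓝 (-(K : ℂ) ^ 2)))
    (him : ∀ᶠ i in l, -(K / 2) ≤ (w i).im) : Tendsto (fun i => (w i).im) l (𝓝 K) := by
  have h0 : Tendsto (fun i => ‖w i ^ 2 - -(K : ℂ) ^ 2‖ / (K / 2)) l (𝓝 0) := by
    simpa using (tendsto_iff_norm_sub_tendsto_zero.1 hw).div_const (K / 2)
  refine tendsto_iff_norm_sub_tendsto_zero.2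
    (squeeze_zero' (.of_forall fun _ => norm_nonneg _) ?_ h0)
  filter_upwards [him] with i hi
  -- The bound on Im w keeps the second factor at least K/2 in modulus, so the first must tend to 0.
  have hfac : w i ^ 2 - -(K : ℂ) ^ 2 = (w i - K * Complex.I) * (w i + K * Complex.I) := by
    linear_combination (K : ℂ) ^ 2 * Complex.I_sq
  have h1 : K / 2 ≤ ‖w i + K * Complex.I‖ := by
    refine le_trans ?_ ((le_abs_self _).trans (Complex.abs_im_le_norm _))
    simp
    linarith
  have h2 : ‖(w i).im - K‖ ≤ ‖w i - K * Complex.I‖ := by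
    have := Complex.abs_im_le_norm (w i - K * Complex.I)
    simpa using this
  rw [hfac, norm_mul, le_div_iff₀ (by linarith)]
  gcongr

theorem existsUnique_isTitchmarshWeyl {q : ℝ → ℝ} {ℓ : ℝ} {z : ℂ}
    (hq : ∀ a b, IntervalIntegrable q volume a b) (hℓ : 0 < ℓ) (hper : Function.Periodic q ℓ)
    (α : ℝ) (hz : z.im ≠ 0) : ∃! m : ℂ, IsTitchmarshWeyl q α z m := by
  obtain ⟨u, du, hu⟩ := exists_isSolutionIVP hq z 1 0
  obtain ⟨v, dv, hv⟩ := exists_isSolutionIVP hq z 0 1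
  obtain ⟨m, -, hm, huniq, -⟩ := exists_weyl_floquet hq hℓ hper α hz hu hv
  exact ⟨m, hm, huniq⟩

theorem titchmarshWeylM_eq {q : ℝ → ℝ} {α : ℝ} {z m : ℂ} (hm : IsTitchmarshWeyl q α z m)
    (huniq : ∀ m', IsTitchmarshWeyl q α z m' → m' = m) : titchmarshWeylM q α z = m := by
  have hex : ∃ m : ℂ, IsTitchmarshWeyl q α z m := ⟨m, hm⟩
  rw [titchmarshWeylM, dif_pos hex]
  exact huniq _ hex.choose_spec

/-- The quadratic form of an elliptic unimodular matrix is definite. -/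
theorem quadratic_form_ne_zero {a b c d x y : ℝ} (hdet : a * d - b * c = 1)
    (htr : 0 < 4 - (a + d) ^ 2) (hxy : x ^ 2 + y ^ 2 = 1) :
    c * x ^ 2 + (a - d) * y * x - b * y ^ 2 ≠ 0 := by
  intro h
  -- Complete the square in x here and in y below; using both avoids cases on b or c being zero. The
  -- discriminant is (a − d)² + 4bc = (a + d)² − 4.
  have e1 : (2 * c * x + (a - d) * y) ^ 2 + (4 - (a + d) ^ 2) * y ^ 2 = 0 := by
    linear_combination 4 * c * h + 4 * y ^ 2 * (-hdet)
  have e2 : (2 * b * y - (a - d) * x) ^ 2 + (4 - (a + d) ^ 2) * x ^ 2 = 0 := by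
    linear_combination -4 * b * h + 4 * x ^ 2 * (-hdet)
  nlinarith [sq_nonneg (2 * c * x + (a - d) * y), sq_nonneg (2 * b * y - (a - d) * x)]

theorem isSpectralDensityAt_of_discriminant {q : ℝ → ℝ} {ℓ α lam : ℝ}
    (hq : ∀ a b, IntervalIntegrable q volume a b) (hℓ : 0 < ℓ) (hper : Function.Periodic q ℓ)
    {u du v dv : ℝ → ℝ} (hu : IsSolutionIVP q lam 1 0 u du) (hv : IsSolutionIVP q lam 0 1 v dv)
    (htr : 0 < 4 - (u ℓ + dv ℓ) ^ 2)
    (hden : du ℓ * Real.sin α ^ 2 + (u ℓ - dv ℓ) * Real.cos α * Real.sin α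
      - v ℓ * Real.cos α ^ 2 ≠ 0) :
    IsSpectralDensityAt q α lam
      |Real.sqrt (4 - (u ℓ + dv ℓ) ^ 2) /
        (2 * Real.pi * (du ℓ * Real.sin α ^ 2 + (u ℓ - dv ℓ) * Real.cos α * Real.sin α
          - v ℓ * Real.cos α ^ 2))| := by
  set den : ℝ := du ℓ * Real.sin α ^ 2 + (u ℓ - dv ℓ) * Real.cos α * Real.sin α
      - v ℓ * Real.cos α ^ 2 with hdendef
  set tr : ℝ := u ℓ + dv ℓ with htrdef
  choose U dU hU using fun z : ℂ => exists_isSolutionIVP hq z 1 0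
  choose V dV hV using fun z : ℂ => exists_isSolutionIVP hq z 0 1
  obtain ⟨cU, cdU⟩ := continuous_of_isSolutionIVP hU hq hℓ.le
  obtain ⟨cV, cdV⟩ := continuous_of_isSolutionIVP hV hq hℓ.le
  have eU := (hU lam).unique hu.ofReal.toIsSolution hq (by simp [(hU lam).init, hu.init])
    (by simp [(hU lam).init_deriv, hu.init_deriv]) hℓ.le
  have eV := (hV lam).unique hv.ofReal.toIsSolution hq (by simp [(hV lam).init, hv.init])
    (by simp [(hV lam).init_deriv, hv.init_deriv]) hℓ.le
  set T : ℂ → ℂ := fun z => U z ℓ + dV z ℓ with hT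
  set c : ℂ := (Real.cos α : ℂ) with hc
  set s : ℂ := (Real.sin α : ℂ) with hs
  have hcs : c ^ 2 + s ^ 2 = 1 := by
    rw [hc, hs]; exact_mod_cast Real.cos_sq_add_sin_sq α
  set B : ℂ → ℂ := fun z => -(dU z ℓ * s ^ 2 + (U z ℓ - dV z ℓ) * c * s - V z ℓ * c ^ 2) with hB
  set A : ℂ → ℂ := fun z => U z ℓ * c ^ 2 + (V z ℓ + dU z ℓ) * c * s + dV z ℓ * s ^ 2 with hA
  have hTc : Continuous T := cU.add cdV
  have hBc : Continuous B := by simp only [hB]; fun_prop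
  have hAc : Continuous A := by simp only [hA]; fun_prop
  have hTl : T lam = (tr : ℂ) := by simp [hT, eU, eV, htrdef]
  have hBl : B lam = ((-den : ℝ) : ℂ) := by
    simp only [hB, eU, eV, hdendef, hc, hs]; push_cast; ring
  have hAl : ∃ r : ℝ, A lam = (r : ℂ) :=
    ⟨u ℓ * Real.cos α ^ 2 + (v ℓ + du ℓ) * Real.cos α * Real.sin α + dv ℓ * Real.sin α ^ 2, by
      simp only [hA, eU, eV, hc, hs]; push_cast; ring⟩
  have hBl0 : B lam ≠ 0 := by
    rw [hBl]; exact_mod_cast neg_ne_zero.2 hden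
  set Z : ℝ → ℂ := fun ε => lam + ε * Complex.I with hZ
  have hZlim : Tendsto Z (𝓝[>] 0) (𝓝 (lam : ℂ)) := by
    have : Continuous Z := by simp only [hZ]; fun_prop
    simpa [hZ] using (this.tendsto 0).mono_left nhdsWithin_le_nhds
  set m : ℝ → ℂ := fun ε => titchmarshWeylM q α (Z ε) with hm
  set C : ℂ → ℂ := fun z => (2 * A z - T z) / (2 * B z) with hC
  have hClim : Tendsto (fun ε => (C (Z ε)).im) (𝓝[>] 0) (𝓝 0) := by
    have h1 : Tendsto C (𝓝 lam) (𝓝 (C lam)) :=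
      ContinuousAt.div (by fun_prop) (by fun_prop) (mul_ne_zero two_ne_zero hBl0)
    have h2 := (Complex.continuous_im.tendsto _).comp (h1.comp hZlim)
    have h3 : (C lam).im = 0 := by
      obtain ⟨r, hr⟩ := hAl
      have : C lam = (((2 * r - tr) / (2 * -den) : ℝ) : ℂ) := by
        simp only [hC, hr, hTl, hBl]; push_cast; rfl
      rw [this, Complex.ofReal_im]
    rwa [h3] at h2
  set K : ℝ := |Real.sqrt (4 - tr ^ 2) / (2 * den)| with hK
  have hKpos : 0 < K :=
    abs_pos.2 (div_ne_zero (Real.sqrt_pos.2 htr).ne' (mul_ne_zero two_ne_zero hden))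
  have hBev : ∀ᶠ ε in 𝓝[>] (0 : ℝ), B (Z ε) ≠ 0 :=
    (hBc.continuousAt.tendsto.comp hZlim).eventually_ne hBl0
  have hweyl : ∀ᶠ ε in 𝓝[>] (0 : ℝ), 0 < (m ε).im ∧
      (m ε + C (Z ε)) ^ 2 = (T (Z ε) ^ 2 - 4) / (2 * B (Z ε)) ^ 2 := by
    filter_upwards [self_mem_nhdsWithin, hBev] with ε hε hBε
    have hZim : (Z ε).im = ε := by simp [hZ]
    have hε0 : (0 : ℝ) < ε := hε
    obtain ⟨n, ρ, hn, huniq, hpos, hρ, e1, e2⟩ := exists_weyl_floquet hq hℓ hper α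
      (by rw [hZim]; exact hε0.ne') (hU (Z ε)) (hV (Z ε))
    have hmn : m ε = n := titchmarshWeylM_eq hn huniq
    rw [hZim] at hpos
    rw [hmn]
    refine ⟨pos_of_mul_pos_right hpos hε0.le, ?_⟩
    -- The component of the eigenvector equation along (cos α, sin α).
    have hBn : B (Z ε) * n = ρ - A (Z ε) := by
      simp only [hB, hA]
      linear_combination c * e1 + s * e2 + ρ * hcs
    have hw : n + C (Z ε) = (2 * ρ - T (Z ε)) / (2 * B (Z ε)) := by
      simp only [hC]
      field_simp
      linear_combination 2 * hBn
    rw [hw, div_pow]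
    congr 1
    simp only [hT]
    linear_combination 4 * hρ
  have hsq : Tendsto (fun ε => (m ε + C (Z ε)) ^ 2) (𝓝[>] 0) (𝓝 (-(K : ℂ) ^ 2)) := by
    have h1 : Tendsto (fun z => (T z ^ 2 - 4) / (2 * B z) ^ 2) (𝓝 (lam : ℂ))
        (𝓝 ((T lam ^ 2 - 4) / (2 * B lam) ^ 2)) :=
      ContinuousAt.div (by fun_prop) (by fun_prop)
        (pow_ne_zero 2 (mul_ne_zero two_ne_zero hBl0))
    have h2 : (T lam ^ 2 - 4) / (2 * B lam) ^ 2 = -(K : ℂ) ^ 2 := by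
      have : K ^ 2 = (4 - tr ^ 2) / (2 * den) ^ 2 := by
        rw [hK, sq_abs, div_pow, Real.sq_sqrt htr.le]
      rw [hTl, hBl, ← Complex.ofReal_pow K, this]
      push_cast
      rw [← neg_div]
      congr 1 <;> ring
    rw [h2] at h1
    exact (h1.comp hZlim).congr' (hweyl.mono fun ε h => h.2.symm)
  -- Positivity of Im m together with Im C → 0 selects the root with limit +K.
  have him : ∀ᶠ ε in 𝓝[>] (0 : ℝ), -(K / 2) ≤ (m ε + C (Z ε)).im := by
    filter_upwards [hweyl, hClim.eventually (lt_mem_nhds (show -(K / 2) < 0 by linarith))]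
      with ε h1 h2
    rw [Complex.add_im]
    linarith [h1.1]
  have hlim := ((tendsto_im_of_tendsto_sq hKpos hsq him).sub hClim).const_mul (1 / Real.pi)
  have hval : 1 / Real.pi * (K - 0) = |Real.sqrt (4 - tr ^ 2) / (2 * Real.pi * den)| := by
    rw [hK, sub_zero, abs_div, abs_div, abs_mul, abs_mul, abs_mul, abs_of_pos Real.pi_pos]
    have := Real.pi_pos
    field_simp
  rw [hval] at hlim
  refine hlim.congr fun ε => ?_
  simp [hm, hZ]

end Hill

theorem theorem3 (q : ℝ → ℝ) (ℓ : ℝ) (hℓ : 0 < ℓ) (hper : Function.Periodic q ℓ)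
    (hint : IntervalIntegrable q volume 0 ℓ) (α : ℝ) (hα : α ∈ Ico 0 Real.pi) :
    (∀ z : ℂ, z.im ≠ 0 → ∃! m : ℂ, Hill.IsTitchmarshWeyl q α z m) ∧
    ∀ a b : ℝ, Hill.IsStabilityInterval q ℓ a b → ∀ lam ∈ Ioo a b,
      ∀ u du v dv : ℝ → ℝ,
        Hill.IsSolutionIVP q lam 1 0 u du → Hill.IsSolutionIVP q lam 0 1 v dv →
        0 < 4 - (u ℓ + dv ℓ) ^ 2 ∧
        du ℓ * Real.sin α ^ 2 + (u ℓ - dv ℓ) * Real.cos α * Real.sin α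
          - v ℓ * Real.cos α ^ 2 ≠ 0 ∧
        Hill.IsSpectralDensityAt q α lam
          |Real.sqrt (4 - (u ℓ + dv ℓ) ^ 2) /
            (2 * Real.pi * (du ℓ * Real.sin α ^ 2 + (u ℓ - dv ℓ) * Real.cos α * Real.sin α
              - v ℓ * Real.cos α ^ 2))| := by
  have hq : ∀ a b, IntervalIntegrable q volume a b := hper.intervalIntegrable₀ hℓ.ne' hint
  refine ⟨fun z hz => Hill.existsUnique_isTitchmarshWeyl hq hℓ hper α hz, ?_⟩
  intro a b hab lam hlam u du v dv hu hv
  have htr := Hill.discriminant_sq_lt hq hℓ hab hlam hu hv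
  have hden := Hill.quadratic_form_ne_zero (Hill.wronskian_fundamental hu hv hq hℓ.le) htr
    (Real.sin_sq_add_cos_sq α)
  exact ⟨htr, hden, Hill.isSpectralDensityAt_of_discriminant hq hℓ hper hu hv htr hden⟩
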